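/- Let $0<L<\infty$, $\gamma>0$, $0\neq f\in L^2_{per}[0,L]$ (time independent), and consider the damped driven nonlinear Schrödinger equation $$iu_t+u_{xx}+|u|^2u+i\gamma u=f,\qquad u(t,x+L)=u(t,x),$$ with solution operator $S(t)$ on $H^2_{per}[0,L]$. Here $\|\cdot\|$ is the norm of $L^2[0,L]$, $\|u\|_{H^2}^2=\|u\|^2+\|u_{xx}\|^2$, and solutions are continuous in time with values in $H^2_{per}$, differentiable in time with values in $L^2_{per}$, and satisfy the equation in $L^2_{per}$. Let $\mathcal A\subset H^2_{per}$ be the global attractor, i.e. the maximal compact invariant set (the union of all compact $K\subset H^2_{per}$ with $S(t)K=K$ for all $t\ge 0$). Let $P_m$ ($m\in\mathbb N$, $m\geq 0$) be the orthogonal projection of $L^2_{per}$ onto $\mathrm{span}\{e^{2\pi i kx/L}:k\in\mathbb Z,\ |k|\le m\}$. For $c,\gamma>0$ and $F\ge 0$ put $$R_0=\frac{F}{\gamma},\quad K_1=6\gamma F R_0,\quad K_2=\frac{3c^2R_0^6}{16}+\frac12 cR_0^4+2FR_0+\frac23R_0^2,\quad R_1=\sqrt{\frac{6\gamma K_2+K_1}{\gamma}},$$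 $$K_5=\frac{c\,(R_0^{1/2}R_1^2)^4}{\gamma^3}+\frac{c\,\{R_0R_1[R_0^2R_1+\gamma R_0+F]\}^2}{\gamma},\quad K_6=2K_5+c\gamma F^2,\quad K_7=c\,(R_0R_1^3+F^2),$$ $$R_2=\sqrt{\frac{4K_6}{\gamma}+4K_7}+R_0,\quad R'=R_2+cR_0^2R_1+\gamma R_0+F,\quad R_\infty=cR_0R_1,$$ $$K_{11}=K_{11}(c,\gamma,F)=\sqrt{\frac{c\gamma R_\infty+c\gamma^{-1/3}R_\infty^{2/3}(R')^{4/3}}{\gamma}}.$$ **Theorem 3.1.** For every $L_0>0$ there is a constant $c>0$, depending only on $L_0$, such that the following holds for every $L\ge L_0$. 1. For all $\gamma>0$, all $0\neq f\in L^2_{per}[0,L]$ and all $m\in\mathbb N$ with $$m\ \ge\ \frac{L}{2\pi}K_{11}(c,\gamma,\|f\|)-1,$$ the projection $P_m$ is determining: if $u_1,u_2:\mathbb R\to\mathcal A$ are complete trajectories of the equation and $P_mu_1(t)=P_mu_2(t)$ for all $t\in\mathbb R$, then $u_1(t)=u_2(t)$ for all $t\in\mathbb R$. 2. Let $m(\gamma,F)$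 be the least $m\in\mathbb N$ with $m\ge \frac{L}{2\pi}K_{11}(c,\gamma,F)-1$, where $F=\|f\|$. Then $m(\gamma,F)=O(F^{10})$ as $F\to\infty$, for each fixed $\gamma>0$, and $m(\gamma,F)=O(\gamma^{-12})$ as $\gamma\to0^+$, for each fixed $F>0$. -/

import Mathlib

open MeasureTheory Filter Topology Asymptotics
open scoped ContDiff

namespace NLS

noncomputable section

/-- `L²_per[0, L]`: complex square integrable functions on the circle `ℝ / Lℤ`, with the
unnormalised norm `‖f‖² = ∫₀ᴸ |f|²`. -/
abbrev L2per (L : ℝ) [Fact (0 < L)] : Type :=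
  Lp ℂ 2 (volume : Measure (AddCircle L))

/-- `v` is the weak derivative of the `L`-periodic function `u`: integration by parts against
every smooth `L`-periodic test function `φ`. -/
def HasWeakDeriv {L : ℝ} [Fact (0 < L)] (u v : L2per L) : Prop :=
  ∀ φ : ℝ → ℂ, ContDiff ℝ ∞ φ → Function.Periodic φ L →
    ∫ x in (0 : ℝ)..L, u (x : AddCircle L) * deriv φ x =
      -∫ x in (0 : ℝ)..L, v (x : AddCircle L) * φ x

lemma ae_of_ae_circle {L : ℝ} [hL : Fact (0 < L)] {p : AddCircle L → Prop}
    (h : ∀ᵐ y, p y) : ∀ᵐ x : ℝ, x ∈ Set.uIoc 0 L → p (x : AddCircle L) := by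
  have h1 := (AddCircle.measurePreserving_mk L 0).quasiMeasurePreserving.ae h
  rw [ae_restrict_iff' measurableSet_Ioc] at h1
  rw [Set.uIoc_of_le hL.out.le]
  simpa using h1

lemma intervalIntegrable_mul {L : ℝ} [hL : Fact (0 < L)] (u : L2per L) {φ : ℝ → ℂ}
    (hφ : Continuous φ) :
    IntervalIntegrable (fun x : ℝ => u (x : AddCircle L) * φ x) volume 0 L := by
  have h1 : Integrable (u : AddCircle L → ℂ) volume :=
    (Lp.memLp u).integrable (by norm_num)
  have h2 := (AddCircle.measurePreserving_mk L 0).integrable_comp_of_integrable h1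
  have h3 : IntervalIntegrable (fun x : ℝ => u (x : AddCircle L)) volume 0 L := by
    rw [intervalIntegrable_iff_integrableOn_Ioc_of_le hL.out.le]
    simpa [IntegrableOn, Function.comp_def] using h2
  exact h3.mul_continuousOn hφ.continuousOn

lemma HasWeakDeriv.zero {L : ℝ} [hL : Fact (0 < L)] :
    HasWeakDeriv (0 : L2per L) 0 := by
  intro φ _ _
  have e (ψ : ℝ → ℂ) :
      ∫ x in (0 : ℝ)..L, (0 : L2per L) (x : AddCircle L) * ψ x = 0 := by
    rw [intervalIntegral.integral_congr_ae (g := fun _ => (0 : ℂ))]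
    · simp
    · exact Eventually.of_forall fun x _ => by simp
  rw [e, e, neg_zero]

lemma HasWeakDeriv.add {L : ℝ} [hL : Fact (0 < L)] {u v u' v' : L2per L}
    (h : HasWeakDeriv u v) (h' : HasWeakDeriv u' v') : HasWeakDeriv (u + u') (v + v') := by
  intro φ hφ hp
  have e (a b : L2per L) (ψ : ℝ → ℂ) (hψ : Continuous ψ) :
      ∫ x in (0 : ℝ)..L, (a + b) (x : AddCircle L) * ψ x =
        (∫ x in (0 : ℝ)..L, a (x : AddCircle L) * ψ x) +
          ∫ x in (0 : ℝ)..L, b (x : AddCircle L) * ψ x := by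
    rw [← intervalIntegral.integral_add (intervalIntegrable_mul a hψ)
      (intervalIntegrable_mul b hψ)]
    apply intervalIntegral.integral_congr_ae
    filter_upwards [ae_of_ae_circle (Lp.coeFn_add a b)] with x hx hm
    rw [hx hm, Pi.add_apply, add_mul]
  have hd : Continuous (deriv φ) := hφ.continuous_deriv (by simp)
  rw [e u u' _ hd, e v v' _ hφ.continuous, h φ hφ hp, h' φ hφ hp]
  ring

lemma HasWeakDeriv.smul {L : ℝ} [hL : Fact (0 < L)] {u v : L2per L} (a : ℂ)
    (h : HasWeakDeriv u v) : HasWeakDeriv (a • u) (a • v) := by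
  intro φ hφ hp
  have e (b : L2per L) (ψ : ℝ → ℂ) :
      ∫ x in (0 : ℝ)..L, (a • b) (x : AddCircle L) * ψ x =
        a * ∫ x in (0 : ℝ)..L, b (x : AddCircle L) * ψ x := by
    rw [← intervalIntegral.integral_const_mul]
    apply intervalIntegral.integral_congr_ae
    filter_upwards [ae_of_ae_circle (Lp.coeFn_smul a b)] with x hx hm
    rw [hx hm, Pi.smul_apply, smul_eq_mul, mul_assoc]
  rw [e, e, h φ hφ hp]
  ring

/-- `H²_per[0, L]`, an element being the pair `(u, u_xx)` of an `L²` function with weak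
derivatives `u_x`, `u_xx` in `L²`, and its second derivative.
The norm is `‖u‖²_{H²} = ‖u‖² + ‖u_xx‖²`. -/
def H2per (L : ℝ) [Fact (0 < L)] : Submodule ℂ (WithLp 2 (L2per L × L2per L)) where
  carrier := {p | ∃ v : L2per L, HasWeakDeriv p.fst v ∧ HasWeakDeriv v p.snd}
  zero_mem' := ⟨0, HasWeakDeriv.zero, HasWeakDeriv.zero⟩
  add_mem' := by
    rintro p q ⟨v, h1, h2⟩ ⟨w, h3, h4⟩
    exact ⟨v + w, h1.add h3, h2.add h4⟩
  smul_mem' := by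
    rintro a p ⟨v, h1, h2⟩
    exact ⟨a • v, h1.smul a, h2.smul a⟩

/-- The function underlying an element of `H²_per`. -/
def fn {L : ℝ} [Fact (0 < L)] (u : H2per L) : L2per L := u.1.fst

/-- The second derivative `u_xx` of an element of `H²_per`. -/
def xx {L : ℝ} [Fact (0 < L)] (u : H2per L) : L2per L := u.1.snd

/-- `u` is a (strong) solution on the time set `J` of
`i u_t + u_xx + |u|² u + i γ u = f` with `L`-periodic boundary conditions: it is continuous with
values in `H²_per`, differentiable with values in `L²_per`, and the equation holds in `L²_per`
at every time. -/
def IsSolutionOn {L : ℝ} [Fact (0 < L)] (γ : ℝ) (f : L2per L) (J : Set ℝ)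
    (u : ℝ → H2per L) : Prop :=
  ContinuousOn u J ∧
  ∀ t ∈ J, ∃ v : L2per L, HasDerivWithinAt (fun s => fn (u s)) v J t ∧
    ∀ᵐ x : AddCircle L,
      Complex.I * v x + xx (u t) x + (‖fn (u t) x‖ : ℂ) ^ 2 * fn (u t) x
        + Complex.I * (γ : ℂ) * fn (u t) x = f x

/-- The image `S(t) K` of a set of initial data under the solution operator at time `t`. -/
def flowImage {L : ℝ} [Fact (0 < L)] (γ : ℝ) (f : L2per L) (t : ℝ) (K : Set (H2per L)) :
    Set (H2per L) :=
  {w | ∃ u : ℝ → H2per L, IsSolutionOn γ f (Set.Ici 0) u ∧ u 0 ∈ K ∧ u t = w}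

/-- `K` is invariant under the solution operator: `S(t) K = K` for all `t ≥ 0`. -/
def IsInvariant {L : ℝ} [Fact (0 < L)] (γ : ℝ) (f : L2per L) (K : Set (H2per L)) : Prop :=
  ∀ t : ℝ, 0 ≤ t → flowImage γ f t K = K

/-- The global attractor, the maximal compact invariant set, defined as the union of all the
compact invariant subsets of `H²_per`; see `globalAttractor_eq`. -/
def globalAttractor {L : ℝ} [Fact (0 < L)] (γ : ℝ) (f : L2per L) : Set (H2per L) :=
  ⋃₀ {K | IsCompact K ∧ IsInvariant γ f K}

lemma globalAttractor_eq {L : ℝ} [Fact (0 < L)] (γ : ℝ) (f : L2per L) (A : Set (H2per L))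
    (hA : IsGreatest {K : Set (H2per L) | IsCompact K ∧ IsInvariant γ f K} A) :
    globalAttractor γ f = A :=
  Set.Subset.antisymm (Set.sUnion_subset fun _ hK => hA.2 hK) (Set.subset_sUnion_of_mem hA.1)

/-- `u` is a complete trajectory in the global attractor. -/
def IsAttractorTrajectory {L : ℝ} [Fact (0 < L)] (γ : ℝ) (f : L2per L) (u : ℝ → H2per L) :
    Prop :=
  IsSolutionOn γ f Set.univ u ∧ ∀ t, u t ∈ globalAttractor γ f

/-- The Fourier mode `e^{2πikx/L}` in `L²_per`. -/
def mode (L : ℝ) [Fact (0 < L)] (k : ℤ) : L2per L :=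
  ContinuousMap.toLp 2 (volume : Measure (AddCircle L)) ℂ (fourier k)

/-- `H_m = span {e^{2πikx/L} : |k| ≤ m}`. -/
def modeSpan (L : ℝ) [Fact (0 < L)] (m : ℕ) : Submodule ℂ (L2per L) :=
  Submodule.span ℂ (mode L '' {k : ℤ | |k| ≤ (m : ℤ)})

instance (L : ℝ) [Fact (0 < L)] (m : ℕ) : FiniteDimensional ℂ (modeSpan L m) :=
  FiniteDimensional.span_of_finite ℂ <| by
    refine Set.Finite.image _ ((Set.finite_Icc (-(m : ℤ)) m).subset fun k hk => ?_)
    exact abs_le.mp hk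

/-- The orthogonal projection `P_m` of `L²_per` onto `H_m`. -/
def P (L : ℝ) [Fact (0 < L)] (m : ℕ) : L2per L →L[ℂ] L2per L :=
  (modeSpan L m).starProjection

/-- `P_m` is determining: complete trajectories in the global attractor whose `P_m` projections
agree for all time are equal. -/
def IsDetermining {L : ℝ} [Fact (0 < L)] (γ : ℝ) (f : L2per L) (m : ℕ) : Prop :=
  ∀ u₁ u₂ : ℝ → H2per L, IsAttractorTrajectory γ f u₁ → IsAttractorTrajectory γ f u₂ →
    (∀ t, P L m (fn (u₁ t)) = P L m (fn (u₂ t))) → ∀ t, u₁ t = u₂ t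

/-! The bounding expressions at `μ = 0`, as functions of the generic constant `c`, the damping
`γ` and `F = ‖f‖`. -/

/-- The `L²` bound. -/
def R0 (γ F : ℝ) : ℝ := F / γ

def K1 (γ F : ℝ) : ℝ := 6 * γ * F * R0 γ F

def K2 (c γ F : ℝ) : ℝ :=
  3 * c ^ 2 * R0 γ F ^ 6 / 16 + 1 / 2 * c * R0 γ F ^ 4 + 2 * F * R0 γ F + 2 / 3 * R0 γ F ^ 2

/-- The `H¹` bound. -/
def R1 (c γ F : ℝ) : ℝ := √((6 * γ * K2 c γ F + K1 γ F) / γ)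

def K5 (c γ F : ℝ) : ℝ :=
  c * (√(R0 γ F) * R1 c γ F ^ 2) ^ 4 / γ ^ 3
    + c * (R0 γ F * R1 c γ F * (R0 γ F ^ 2 * R1 c γ F + γ * R0 γ F + F)) ^ 2 / γ

def K6 (c γ F : ℝ) : ℝ := 2 * K5 c γ F + c * γ * F ^ 2

def K7 (c γ F : ℝ) : ℝ := c * (R0 γ F * R1 c γ F ^ 3 + F ^ 2)

/-- The `H²` bound. -/
def R2 (c γ F : ℝ) : ℝ := √(4 * K6 c γ F / γ + 4 * K7 c γ F) + R0 γ F

/-- The bound of the time derivative in `L²`. -/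
def R' (c γ F : ℝ) : ℝ := R2 c γ F + c * R0 γ F ^ 2 * R1 c γ F + γ * R0 γ F + F

/-- The bound of the square of the `L^∞` norm. -/
def Rinf (c γ F : ℝ) : ℝ := c * R0 γ F * R1 c γ F

def K11 (c γ F : ℝ) : ℝ :=
  √((c * γ * Rinf c γ F
      + c * γ ^ (-(1 / 3) : ℝ) * Rinf c γ F ^ (2 / 3 : ℝ) * R' c γ F ^ (4 / 3 : ℝ)) / γ)

/-- The least natural number `m` with `m ≥ (L / 2π) K₁₁ - 1`. -/
def modeCount (c L γ F : ℝ) : ℕ := ⌈L / (2 * Real.pi) * K11 c γ F - 1⌉₊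

end

end NLS

/-!
Two complete trajectories in the attractor whose low Fourier modes agree differ by a function `δ`
without low modes. For such `δ` the Poincaré inequality makes `‖δ‖` small compared with `‖δ_x‖`. The
difference solves a linear Schrödinger equation with damping `γ`, with potentials
`|u₁ + u₂|² / 2` and `(u₁² + u₂²) / 2`, and its energy
`Φ = ‖δ_x‖² - ½ ∫ (|u₁ + u₂|² |δ|² + Re ((ū₁² + ū₂²) δ²))` satisfies `Φ' = -2γ Φ + r`, where `r` only
contains the time derivatives of the potentials (`SolvesAt.hasDerivAt_diffEnergy`). Hence
`|r| ≤ C ‖u‖_∞ ‖u_t‖ ‖δ‖^{3/2} ‖δ_x‖^{1/2}`, which is at most `γ Φ` if the first mode present in `δ` is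
beyond `K11`; then `Φ` decays exponentially, and since it is bounded on the whole time axis it is
zero (`isDetermining_of_K11_le`).

This requires bounds of `‖u‖_∞` and `‖u_t‖` on the attractor. A functional `Φ` on `H²_per` with
`(Φ ∘ u)' ≤ -2γ Φ + 2γ C` along solutions satisfies `Φ ≤ C` on every compact invariant set, because
each point of the set has arbitrarily long histories in it (`le_of_isInvariant`). The bound `C` may
involve the maximum over the set of the quantity to be estimated, as long as it does so
subquadratically. This principle is applied to `‖u‖²`, to the energy, and to
`‖u_t‖² + Re ∫ ū² u_x²`. In the last one the corrector cancels the only term, `Im ∫ ū² u_t²`, that the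
damping does not control (`norm_fn_le_R0`, `norm_dx_le_R1`, `norm_vel_le_R'`).

Solutions are merely continuous in `H²_per` and differentiable in `L²_per`, so that terms
with `u_x` cannot be differentiated by the chain rule. Their increments in time are written, after
an integration by parts, as inner products with the increment of `u` (`hasDerivAt_of_factor`); for
`‖u_t‖²` the identity is obtained from difference quotients (`hasDerivAt_norm_vel_sq`).

The growth of the number of modes follows by counting powers in the definition of `K11`.
-/

namespace NLS

noncomputable section

section

/-! ### `L²_per` as a module over the continuous functions -/

variable {L : ℝ} [hL : Fact (0 < L)]

/-- Continuous complex functions on the circle. -/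
abbrev Cper (L : ℝ) [Fact (0 < L)] : Type := C(AddCircle L, ℂ)

/-- The inclusion of continuous functions in `L²_per`. -/
def T (L : ℝ) [Fact (0 < L)] : Cper L →L[ℂ] L2per L :=
  ContinuousMap.toLp 2 (volume : Measure (AddCircle L)) ℂ

lemma coeFn_T (g : Cper L) : (T L g : AddCircle L → ℂ) =ᵐ[volume] g :=
  ContinuousMap.coeFn_toLp _ _

lemma T_injective : Function.Injective (T L) := ContinuousMap.toLp_injective _

lemma memLp_mul (g : Cper L) (w : L2per L) :
    MemLp (fun x => g x * w x) 2 (volume : Measure (AddCircle L)) := by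
  refine (Lp.memLp w).of_le_mul (c := ‖g‖)
    (g.continuous.aestronglyMeasurable.mul (Lp.aestronglyMeasurable w))
    (Eventually.of_forall fun x => ?_)
  rw [norm_mul]
  gcongr
  exact g.norm_coe_le_norm x

/-- Multiplication of an `L²` function by a continuous function. -/
def M (L : ℝ) [Fact (0 < L)] : Cper L →L[ℂ] L2per L →L[ℂ] L2per L :=
  LinearMap.mkContinuous₂
    (LinearMap.mk₂ ℂ (fun (g : Cper L) (w : L2per L) => (memLp_mul g w).toLp _)
      (by
        intro g h w
        rw [← MemLp.toLp_add]
        congr 1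
        ext x
        simp [add_mul])
      (by
        intro c g w
        rw [← MemLp.toLp_const_smul]
        congr 1
        ext x
        simp [mul_assoc])
      (by
        intro g w w'
        rw [← MemLp.toLp_add]
        apply MemLp.toLp_congr
        filter_upwards [Lp.coeFn_add w w'] with x hx
        change g x * (w + w' : L2per L) x = _
        rw [hx, Pi.add_apply, mul_add]
        rfl)
      (by
        intro c g w
        rw [← MemLp.toLp_const_smul]
        apply MemLp.toLp_congr
        filter_upwards [Lp.coeFn_smul c w] with x hx
        simp [hx, mul_left_comm])) 1
    (by
      intro g w
      rw [one_mul]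
      refine Lp.norm_le_mul_norm_of_ae_le_mul ?_
      filter_upwards [(memLp_mul g w).coeFn_toLp] with x hx
      simp only [LinearMap.mk₂_apply]
      rw [hx, norm_mul]
      gcongr
      exact g.norm_coe_le_norm x)

lemma coeFn_M (g : Cper L) (w : L2per L) :
    (M L g w : AddCircle L → ℂ) =ᵐ[volume] fun x => g x * w x :=
  (memLp_mul g w).coeFn_toLp

lemma norm_M_le (g : Cper L) (w : L2per L) : ‖M L g w‖ ≤ ‖g‖ * ‖w‖ := by
  refine Lp.norm_le_mul_norm_of_ae_le_mul ?_
  filter_upwards [coeFn_M g w] with x hx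
  rw [hx, norm_mul]
  gcongr
  exact g.norm_coe_le_norm x

/-- Complex conjugation on `L²_per`. -/
def cj (L : ℝ) [Fact (0 < L)] : L2per L →L[ℝ] L2per L :=
  ContinuousLinearMap.compLpL 2 volume (Complex.conjCLE : ℂ →L[ℝ] ℂ)

lemma coeFn_cj (w : L2per L) :
    (cj L w : AddCircle L → ℂ) =ᵐ[volume] fun x => star (w x) :=
  ContinuousLinearMap.coeFn_compLpL _ _

lemma norm_cj (w : L2per L) : ‖cj L w‖ = ‖w‖ := by
  apply le_antisymm <;> apply Lp.norm_le_norm_of_ae_le <;>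
  · filter_upwards [coeFn_cj w] with x hx
    simp [hx]

lemma M_T (g h : Cper L) : M L g (T L h) = T L (g * h) := by
  apply Lp.ext
  filter_upwards [coeFn_M g (T L h), coeFn_T h, coeFn_T (g * h)] with x h1 h2 h3
  rw [h1, h2, h3, ContinuousMap.mul_apply]

lemma cj_T (g : Cper L) : cj L (T L g) = T L (star g) := by
  apply Lp.ext
  filter_upwards [coeFn_cj (T L g), coeFn_T g, coeFn_T (star g)] with x h1 h2 h3
  rw [h1, h2, h3, ContinuousMap.star_apply]

lemma cj_cj (w : L2per L) : cj L (cj L w) = w := by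
  apply Lp.ext
  filter_upwards [coeFn_cj (cj L w), coeFn_cj w] with x h1 h2
  rw [h1, h2, star_star]

lemma cj_smul (c : ℂ) (w : L2per L) : cj L (c • w) = star c • cj L w := by
  apply Lp.ext
  filter_upwards [coeFn_cj (c • w), Lp.coeFn_smul c w, Lp.coeFn_smul (star c) (cj L w),
    coeFn_cj w] with x h1 h2 h3 h4
  rw [h1, h2, h3, Pi.smul_apply, Pi.smul_apply, h4, smul_eq_mul, star_mul', smul_eq_mul]

/-- Real inner products (`Re ∫ ā b`) are used throughout, multiplication by `g` having the adjoint
multiplication by `ḡ`. -/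
lemma inner_M_left (g : Cper L) (a b : L2per L) :
    inner ℝ (M L g a) b = inner ℝ a (M L (star g) b) := by
  rw [L2.inner_def, L2.inner_def]
  apply integral_congr_ae
  filter_upwards [coeFn_M g a, coeFn_M (star g) b] with x h1 h2
  rw [h1, h2, ContinuousMap.star_apply]
  simp [Complex.inner, Complex.mul_re, Complex.mul_im]
  ring

lemma inner_I_smul_left (a b : L2per L) :
    inner ℝ (Complex.I • a) b = - inner ℝ a (Complex.I • b) := by
  rw [L2.inner_def, L2.inner_def, ← integral_neg]
  apply integral_congr_ae
  filter_upwards [Lp.coeFn_smul Complex.I a, Lp.coeFn_smul Complex.I b] with x h1 h2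
  rw [h1, h2]
  simp [Complex.inner, Complex.mul_re, Complex.mul_im]
  ring

lemma inner_I_smul_self (a : L2per L) : inner ℝ a (Complex.I • a) = 0 := by
  have h := inner_I_smul_left a a
  rw [real_inner_comm] at h
  linarith

lemma inner_cj_cj (a b : L2per L) : inner ℝ (cj L a) (cj L b) = inner ℝ a b := by
  rw [L2.inner_def, L2.inner_def]
  apply integral_congr_ae
  filter_upwards [coeFn_cj a, coeFn_cj b] with x h1 h2
  rw [h1, h2]
  simp [Complex.inner, Complex.mul_re]

lemma real_inner_eq_re (a b : L2per L) : inner ℝ a b = (inner ℂ a b).re := by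
  rw [L2.inner_def, L2.inner_def]
  have := integral_re (𝕜 := ℂ) (L2.integrable_inner (𝕜 := ℂ) a b)
  simp only [RCLike.re_to_complex] at this
  rw [← this]
  apply integral_congr_ae
  filter_upwards with x
  simp [Complex.inner, Complex.mul_re]

end

section

/-! ### Fourier modes and the closed derivative -/

/-- The wave number of the `k`-th Fourier mode, times `i`. -/
def ik (L : ℝ) (k : ℤ) : ℂ := 2 * Real.pi * Complex.I * k / L

lemma ik_add (L : ℝ) (j k : ℤ) : ik L (j + k) = ik L j + ik L k := by
  simp only [ik]; push_cast; ring

variable {L : ℝ} [hL : Fact (0 < L)]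

lemma mode_eq (k : ℤ) : mode L k = T L (fourier k) := rfl

lemma inner_mode (k : ℤ) (w : L2per L) :
    inner ℂ (mode L k) w = ∫ x : AddCircle L, w x * fourier (-k) x := by
  rw [L2.inner_def]
  apply integral_congr_ae
  filter_upwards [coeFn_T (fourier k : Cper L)] with x hx
  rw [mode_eq, hx, RCLike.inner_apply, fourier_neg]

lemma inner_mode_mode (j k : ℤ) :
    inner ℂ (mode L j) (mode L k) = if j = k then (L : ℂ) else 0 := by
  have h1 : inner ℂ (mode L j) (mode L k) = (L : ℂ) * fourierCoeff (fourier k : Cper L) j := by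
    rw [inner_mode, fourierCoeff, AddCircle.integral_haarAddCircle, Complex.real_smul,
      Complex.ofReal_inv, mul_inv_cancel_left₀ (by exact_mod_cast hL.out.ne')]
    apply integral_congr_ae
    filter_upwards [coeFn_T (fourier k : Cper L)] with x hx
    rw [mode_eq, hx, smul_eq_mul, mul_comm]
  rw [h1, fourierCoeff_fourier, Pi.single_apply]
  split_ifs <;> simp

/-- The normalised Fourier modes. -/
def nmode (L : ℝ) [Fact (0 < L)] (k : ℤ) : L2per L := ((√L)⁻¹ : ℂ) • mode L k

lemma sqrt_mul_sqrt_L : (√L : ℂ) * (√L : ℂ) = L := by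
  rw [← Complex.ofReal_mul, Real.mul_self_sqrt hL.out.le]

lemma sqrt_L_ne : (√L : ℂ) ≠ 0 := by
  exact_mod_cast (Real.sqrt_pos.2 hL.out).ne'

lemma mode_eq_smul_nmode (k : ℤ) : mode L k = (√L : ℂ) • nmode L k := by
  rw [nmode, smul_smul, mul_inv_cancel₀ sqrt_L_ne, one_smul]

lemma orthonormal_nmode : Orthonormal ℂ (nmode L) := by
  classical
  rw [orthonormal_iff_ite]
  intro j k
  have h := sqrt_L_ne (L := L)
  rw [nmode, nmode, inner_smul_left, inner_smul_right, inner_mode_mode]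
  split_ifs
  · rw [← sqrt_mul_sqrt_L (L := L), map_inv₀, Complex.conj_ofReal]
    field_simp
  · simp

lemma dense_span_nmode : ⊤ ≤ (Submodule.span ℂ (Set.range (nmode L))).topologicalClosure := by
  have h1 : Set.range (mode L) ⊆ Submodule.span ℂ (Set.range (nmode L)) := by
    rintro _ ⟨k, rfl⟩
    rw [mode_eq_smul_nmode]
    exact Submodule.smul_mem _ _ (Submodule.subset_span ⟨k, rfl⟩)
  have h2 : (Submodule.span ℂ (Set.range (mode L))).topologicalClosure = ⊤ := by
    have h0 : DenseRange (T L) := ContinuousMap.toLp_denseRange ℂ _ ℂ (by norm_num)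
    have h := h0.topologicalClosure_map_submodule (span_fourier_closure_eq_top (T := L))
    rw [Submodule.map_span, ← Set.range_comp] at h
    exact h
  rw [← h2]
  exact Submodule.topologicalClosure_mono (Submodule.span_le.2 h1)

/-- The Hilbert basis of normalised Fourier modes. -/
def fbasis (L : ℝ) [Fact (0 < L)] : HilbertBasis ℤ ℂ (L2per L) :=
  HilbertBasis.mk orthonormal_nmode dense_span_nmode

lemma fbasis_apply (k : ℤ) : fbasis L k = nmode L k := by
  rw [fbasis, HilbertBasis.coe_mk]

lemma fbasis_repr (w : L2per L) (k : ℤ) :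
    (fbasis L).repr w k = ((√L)⁻¹ : ℂ) * inner ℂ (mode L k) w := by
  rw [HilbertBasis.repr_apply_apply, fbasis_apply, nmode, inner_smul_left]
  simp

lemma eq_of_inner_mode {v w : L2per L}
    (h : ∀ k, inner ℂ (mode L k) v = inner ℂ (mode L k) w) : v = w := by
  apply (fbasis L).repr.injective
  ext k
  rw [fbasis_repr, fbasis_repr, h]

lemma hasSum_norm_sq (w : L2per L) :
    HasSum (fun k => ‖(fbasis L).repr w k‖ ^ 2) (‖w‖ ^ 2) := by
  have h := (fbasis L).hasSum_inner_mul_inner w w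
  have h2 := (Complex.hasSum_re h)
  convert h2 using 1
  · ext k
    rw [HilbertBasis.repr_apply_apply, ← inner_conj_symm w, ← Complex.normSq_eq_conj_mul_self,
      Complex.ofReal_re, Complex.normSq_eq_norm_sq]
  · rw [inner_self_eq_norm_sq_to_K]
    norm_cast

lemma norm_ik (k : ℤ) : ‖ik L k‖ = 2 * Real.pi / L * |(k : ℝ)| := by
  have h := hL.out
  simp only [ik, norm_div, norm_mul, Complex.norm_ofNat, Complex.norm_real, Complex.norm_I,
    Complex.norm_intCast, Real.norm_eq_abs, abs_of_pos h, abs_of_pos Real.pi_pos]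
  ring

/-- The graph of the derivative `g ↦ g_x`, for continuous `g` with `g_x ∈ L²`, defined as the closure
of the graph on trigonometric polynomials in `C × L²`. Identities that are continuous and linear in
`(g, g_x)` therefore need to be checked on the modes `e^{2πikx/L}` only. -/
def DG (L : ℝ) [Fact (0 < L)] : Submodule ℂ (Cper L × L2per L) :=
  (Submodule.span ℂ (Set.range fun k : ℤ => ((fourier k : Cper L), ik L k • mode L k))
    ).topologicalClosure

lemma DG_induction {p : Cper L × L2per L → Prop} (hc : IsClosed {x | p x}) (h0 : p 0)
    (hadd : ∀ x y, p x → p y → p (x + y)) (hsmul : ∀ (c : ℂ) x, p x → p (c • x))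
    (hb : ∀ k : ℤ, p (fourier k, ik L k • mode L k)) {x : Cper L × L2per L} (hx : x ∈ DG L) :
    p x := by
  have h : DG L ≤ (⟨⟨⟨{x | p x}, fun {a b} => hadd a b⟩, h0⟩, fun c {x} => hsmul c x⟩ :
      Submodule ℂ (Cper L × L2per L)) := by
    apply Submodule.topologicalClosure_minimal
    · rw [Submodule.span_le]
      rintro _ ⟨k, rfl⟩
      exact hb k
    · exact hc
  exact h hx

lemma fourier_mem_DG (k : ℤ) : ((fourier k : Cper L), ik L k • mode L k) ∈ DG L :=
  Submodule.le_topologicalClosure _ (Submodule.subset_span ⟨k, rfl⟩)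

lemma inner_mode_of_DG {g : Cper L} {v : L2per L} (h : (g, v) ∈ DG L) (k : ℤ) :
    inner ℂ (mode L k) v = ik L k * inner ℂ (mode L k) (T L g) := by
  refine DG_induction (p := fun x => inner ℂ (mode L k) x.2 =
    ik L k * inner ℂ (mode L k) (T L x.1)) ?_ ?_ ?_ ?_ ?_ h
  · exact isClosed_eq (by fun_prop) (by fun_prop)
  · simp
  · intro x y hx hy
    simp only [Prod.fst_add, Prod.snd_add, map_add, inner_add_right, hx, hy, mul_add]
  · intro c x hx
    simp only [Prod.smul_fst, Prod.smul_snd, map_smul, inner_smul_right, hx]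
    ring
  · intro j
    simp only [← mode_eq, inner_smul_right, inner_mode_mode]
    split_ifs with hkj
    · rw [hkj]
    · simp

lemma DG_unique {g : Cper L} {v w : L2per L} (h : (g, v) ∈ DG L) (h' : (g, w) ∈ DG L) :
    v = w :=
  eq_of_inner_mode fun k => by rw [inner_mode_of_DG h, inner_mode_of_DG h']

lemma DG_star {g : Cper L} {v : L2per L} (h : (g, v) ∈ DG L) : (star g, cj L v) ∈ DG L := by
  refine DG_induction (p := fun x => (star x.1, cj L x.2) ∈ DG L) ?_ ?_ ?_ ?_ ?_ h
  · exact (Submodule.isClosed_topologicalClosure _).preimage (by fun_prop)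
  · simp [Prod.mk_zero_zero]
  · intro x y hx hy
    simpa using add_mem hx hy
  · intro c x hx
    have := (DG L).smul_mem (star c) hx
    rw [Prod.smul_mk] at this
    simpa [cj_smul] using this
  · intro k
    have h1 : star (fourier k : Cper L) = fourier (-k) := by
      ext x; simp
    have h2 : star (ik L k) = ik L (-k) := by
      simp [ik]
    have := fourier_mem_DG (L := L) (-k)
    simpa only [cj_smul, mode_eq, cj_T, h1, h2] using this

/-- The product rule: `H¹_per` is an algebra. -/
lemma DG_mul {g h : Cper L} {v w : L2per L} (hg : (g, v) ∈ DG L) (hh : (h, w) ∈ DG L) :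
    (g * h, M L g w + M L h v) ∈ DG L := by
  refine DG_induction (p := fun x => (x.1 * h, M L x.1 w + M L h x.2) ∈ DG L) ?_ ?_ ?_ ?_ ?_ hg
  · refine (Submodule.isClosed_topologicalClosure _).preimage ?_
    fun_prop
  · simp [Prod.mk_zero_zero]
  · intro x y hx hy
    convert! add_mem hx hy using 1
    refine Prod.ext (add_mul _ _ _) ?_
    simp only [Prod.fst_add, Prod.snd_add, map_add, add_apply]
    abel
  · intro c x hx
    convert! (DG L).smul_mem c hx using 1
    refine Prod.ext (smul_mul_assoc _ _ _) ?_
    simp only [Prod.smul_fst, Prod.smul_snd, map_smul, smul_apply, smul_add]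
  intro k
  refine DG_induction (p := fun x => ((fourier k : Cper L) * x.1,
    M L (fourier k : Cper L) x.2 + M L x.1 (ik L k • mode L k)) ∈ DG L) ?_ ?_ ?_ ?_ ?_ hh
  · refine (Submodule.isClosed_topologicalClosure _).preimage ?_
    fun_prop
  · simp [Prod.mk_zero_zero]
  · intro x y hx hy
    convert! add_mem hx hy using 1
    refine Prod.ext (mul_add _ _ _) ?_
    simp only [Prod.fst_add, Prod.snd_add, map_add, add_apply]
    abel
  · intro c x hx
    convert! (DG L).smul_mem c hx using 1
    refine Prod.ext (mul_smul_comm _ _ _) ?_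
    simp only [Prod.smul_fst, Prod.smul_snd, map_smul, smul_apply, smul_add]
    rw [smul_comm (ik L k) c]
  · intro j
    have h1 : (fourier k : Cper L) * fourier j = fourier (k + j) := by
      ext x; simp
    have := fourier_mem_DG (L := L) (k + j)
    simp only [map_smul, mode_eq, M_T, mul_comm (fourier j : Cper L), h1]
    rw [← add_smul, add_comm (ik L j), ← ik_add L]
    exact this

/-- Derivatives have mean zero. -/
lemma inner_T_one {g : Cper L} {v : L2per L} (h : (g, v) ∈ DG L) :
    inner ℝ (T L 1) v = 0 := by
  have h1 : (1 : Cper L) = fourier 0 := by ext x; simp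
  have h2 := inner_mode_of_DG h 0
  rw [mode_eq, ← h1] at h2
  rw [real_inner_eq_re, h2]
  simp [ik]

/-- Integration by parts, from the product rule for `ḡ h` and the vanishing of the mean. -/
lemma inner_parts {g h : Cper L} {v w : L2per L} (hg : (g, v) ∈ DG L) (hh : (h, w) ∈ DG L) :
    inner ℝ v (T L h) = - inner ℝ (T L g) w := by
  have h1 := inner_T_one (DG_mul (DG_star hg) hh)
  rw [inner_add_right, real_inner_comm, inner_M_left, real_inner_comm (M L h _),
    inner_M_left, M_T, M_T, star_star, mul_one, mul_one, ← cj_T, inner_cj_cj,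
    real_inner_comm (T L g)] at h1
  linarith

end

section

/-! ### Agmon and Poincaré inequalities -/

variable {L : ℝ} [hL : Fact (0 < L)]

lemma norm_sq_eq_integral (w : L2per L) : ‖w‖ ^ 2 = ∫ x, ‖w x‖ ^ 2 := by
  rw [← real_inner_self_eq_norm_sq, L2.inner_def]
  apply integral_congr_ae
  filter_upwards with x
  rw [real_inner_self_eq_norm_sq]

lemma integrable_norm_mul (a b : L2per L) : Integrable (fun x => ‖a x‖ * ‖b x‖) :=
  (Lp.memLp a).norm.integrable_mul (Lp.memLp b).norm

lemma integral_norm_mul_le (a b : L2per L) : ∫ x, ‖a x‖ * ‖b x‖ ≤ ‖a‖ * ‖b‖ := by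
  have h := integral_mul_norm_le_Lp_mul_Lq (p := 2) (q := 2) (f := a) (g := b)
    (μ := (volume : Measure (AddCircle L)))
    (by constructor <;> norm_num) (by simpa using Lp.memLp a) (by simpa using Lp.memLp b)
  simp only [Real.rpow_two, ← norm_sq_eq_integral] at h
  rwa [← Real.sqrt_eq_rpow, ← Real.sqrt_eq_rpow, Real.sqrt_sq (norm_nonneg _),
    Real.sqrt_sq (norm_nonneg _)] at h

lemma intervalIntegrable_coe (w : L2per L) :
    IntervalIntegrable (fun x : ℝ => w (x : AddCircle L)) volume 0 L := by
  simpa using intervalIntegrable_mul w (φ := fun _ => 1) continuous_const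

lemma uIcc_subset_of_mem {x y : ℝ} (hx : x ∈ Set.Icc 0 L) (hy : y ∈ Set.Icc 0 L) :
    Set.uIcc y x ⊆ Set.uIcc 0 L := by
  rw [Set.uIcc_of_le hL.out.le]
  exact Set.uIcc_subset_Icc hy hx

lemma norm_intervalIntegral_le (w : L2per L) {x y : ℝ} (hx : x ∈ Set.Icc 0 L)
    (hy : y ∈ Set.Icc 0 L) :
    ‖∫ s in y..x, w (s : AddCircle L)‖ ≤ ∫ p : AddCircle L, ‖w p‖ := by
  refine intervalIntegral.norm_integral_le_integral_norm_uIoc.trans ?_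
  have h1 := AddCircle.integral_preimage L 0 (fun p => ‖w p‖)
  rw [zero_add] at h1
  rw [← h1]
  have h2 := (intervalIntegrable_coe w).norm
  rw [intervalIntegrable_iff_integrableOn_Ioc_of_le hL.out.le] at h2
  refine setIntegral_mono_set h2 (Eventually.of_forall fun _ => norm_nonneg _) ?_
  refine LE.le.eventuallyLE ?_
  exact Set.Ioc_subset_Ioc (le_min hy.1 hx.1) (max_le hy.2 hx.2)

lemma intervalIntegral_congr_coe {a : L2per L} {b : AddCircle L → ℂ}
    (hab : (a : AddCircle L → ℂ) =ᵐ[volume] b) {x y : ℝ} (hx : x ∈ Set.Icc 0 L)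
    (hy : y ∈ Set.Icc 0 L) :
    ∫ s in y..x, a (s : AddCircle L) = ∫ s in y..x, b (s : AddCircle L) := by
  apply intervalIntegral.integral_congr_ae
  filter_upwards [ae_of_ae_circle hab] with s hs hm
  apply hs
  rw [Set.uIoc_of_le hL.out.le]
  exact Set.Ioc_subset_Ioc (le_min hy.1 hx.1) (max_le hy.2 hx.2) hm

/-- The integral over the arc between two points, as a continuous functional on `L²_per`. -/
def arc {x y : ℝ} (hx : x ∈ Set.Icc 0 L) (hy : y ∈ Set.Icc 0 L) : L2per L →L[ℂ] ℂ :=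
  LinearMap.mkContinuous
    { toFun := fun w => ∫ s in y..x, w (s : AddCircle L)
      map_add' := by
        intro a b
        rw [intervalIntegral_congr_coe (Lp.coeFn_add a b) hx hy]
        exact intervalIntegral.integral_add
          ((intervalIntegrable_coe a).mono_set (uIcc_subset_of_mem hx hy))
          ((intervalIntegrable_coe b).mono_set (uIcc_subset_of_mem hx hy))
      map_smul' := by
        intro c a
        rw [intervalIntegral_congr_coe (Lp.coeFn_smul c a) hx hy]
        exact intervalIntegral.integral_smul (μ := volume) c
          (fun s : ℝ => a (s : AddCircle L)) } ‖T L 1‖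
    (by
      intro w
      refine (norm_intervalIntegral_le w hx hy).trans
        (le_trans (le_of_eq ?_) (integral_norm_mul_le (T L 1) w))
      apply integral_congr_ae
      filter_upwards [coeFn_T (1 : Cper L)] with p hp
      simp [hp])

lemma arc_apply {x y : ℝ} (hx : x ∈ Set.Icc 0 L) (hy : y ∈ Set.Icc 0 L) (w : L2per L) :
    arc hx hy w = ∫ s in y..x, w (s : AddCircle L) := rfl

/-- The fundamental theorem of calculus; the points are represented in `[0, L]`. -/
lemma sub_eq_arc {g : Cper L} {v : L2per L} (h : (g, v) ∈ DG L) {x y : ℝ}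
    (hx : x ∈ Set.Icc 0 L) (hy : y ∈ Set.Icc 0 L) : g x - g y = arc hx hy v := by
  refine DG_induction (p := fun z => z.1 x - z.1 y = arc hx hy z.2) ?_ ?_ ?_ ?_ ?_ h
  · exact isClosed_eq (by fun_prop) (by fun_prop)
  · simp
  · intro a b ha hb
    simp only [Prod.fst_add, Prod.snd_add, map_add, ContinuousMap.add_apply, ← ha, ← hb]
    ring
  · intro c a ha
    simp only [Prod.smul_fst, Prod.smul_snd, map_smul, ContinuousMap.smul_apply, ← ha, smul_sub]
  · intro k
    rw [map_smul, arc_apply, mode_eq, intervalIntegral_congr_coe (coeFn_T _) hx hy,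
      smul_eq_mul, ← intervalIntegral.integral_const_mul]
    symm
    apply intervalIntegral.integral_eq_sub_of_hasDerivAt
    · intro s _
      exact hasDerivAt_fourier L k s
    · apply Continuous.intervalIntegrable
      exact continuous_const.mul
        ((fourier k : Cper L).continuous.comp (AddCircle.continuous_mk' L))

lemma norm_sq_sub_le {g : Cper L} {v : L2per L} (h : (g, v) ∈ DG L) (p q : AddCircle L) :
    ‖g p‖ ^ 2 ≤ ‖g q‖ ^ 2 + 2 * ‖T L g‖ * ‖v‖ := by
  obtain ⟨x, hx, rfl⟩ := AddCircle.coe_image_Icc_eq (p := L) 0 ▸ Set.mem_univ p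
  obtain ⟨y, hy, rfl⟩ := AddCircle.coe_image_Icc_eq (p := L) 0 ▸ Set.mem_univ q
  rw [zero_add] at hx hy
  have h1 := sub_eq_arc (DG_mul (DG_star h) h) hx hy
  have h2 : ‖arc hx hy (M L (star g) v + M L g (cj L v))‖ ≤ 2 * ‖T L g‖ * ‖v‖ := by
    rw [map_add]
    have e (a : Cper L) (b : L2per L) : ‖arc hx hy (M L a b)‖ ≤ ‖T L a‖ * ‖b‖ := by
      refine (norm_intervalIntegral_le _ hx hy).trans
        (le_trans (le_of_eq ?_) (integral_norm_mul_le (T L a) b))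
      apply integral_congr_ae
      filter_upwards [coeFn_T a, coeFn_M a b] with p hp hp'
      rw [hp, hp', norm_mul]
    have e1 := e (star g) v
    have e2 := e g (cj L v)
    rw [← cj_T, norm_cj] at e1
    rw [norm_cj] at e2
    refine (norm_add_le _ _).trans ?_
    linarith
  rw [← h1] at h2
  have h3 (z : AddCircle L) : (star g * g) z = ((‖g z‖ ^ 2 : ℝ) : ℂ) := by
    rw [ContinuousMap.mul_apply, ContinuousMap.star_apply]
    simp [Complex.conj_mul']
  rw [h3, h3, ← Complex.ofReal_sub, Complex.norm_real] at h2
  have := le_abs_self (‖g x‖ ^ 2 - ‖g y‖ ^ 2)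
  rw [Real.norm_eq_abs] at h2
  linarith

/-- Agmon's inequality, by averaging the bound of `|g(p)|² - |g(q)|²` over `q`. -/
lemma agmon {g : Cper L} {v : L2per L} (h : (g, v) ∈ DG L) :
    ‖g‖ ^ 2 ≤ ‖T L g‖ ^ 2 / L + 2 * ‖T L g‖ * ‖v‖ := by
  have hL0 := hL.out
  have h1 (p : AddCircle L) : ‖g p‖ ^ 2 ≤ ‖T L g‖ ^ 2 / L + 2 * ‖T L g‖ * ‖v‖ := by
    have h2 : ∫ _ : AddCircle L, ‖g p‖ ^ 2 ≤
        ∫ q : AddCircle L, (‖T L g q‖ ^ 2 + 2 * ‖T L g‖ * ‖v‖) := by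
      apply integral_mono_ae (integrable_const _)
      · apply Integrable.add _ (integrable_const _)
        simpa [sq] using integrable_norm_mul (T L g) (T L g)
      · filter_upwards [coeFn_T g] with q hq
        rw [hq]
        exact norm_sq_sub_le h p q
    rw [integral_add (by simpa [sq] using integrable_norm_mul (T L g) (T L g))
      (integrable_const _), ← norm_sq_eq_integral, integral_const, integral_const] at h2
    simp only [measureReal_def, AddCircle.measure_univ, ENNReal.toReal_ofReal hL0.le,
      smul_eq_mul] at h2
    rw [div_add' _ _ _ hL0.ne', le_div_iff₀ hL0]
    linarith
  have h3 : 0 ≤ ‖T L g‖ ^ 2 / L + 2 * ‖T L g‖ * ‖v‖ := by positivity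
  have h4 : ‖g‖ ≤ √(‖T L g‖ ^ 2 / L + 2 * ‖T L g‖ * ‖v‖) := by
    rw [ContinuousMap.norm_le _ (Real.sqrt_nonneg _)]
    exact fun p => Real.le_sqrt_of_sq_le (h1 p)
  calc ‖g‖ ^ 2 ≤ _ := by gcongr
    _ = _ := Real.sq_sqrt h3

/-- The Poincaré inequality for functions without low Fourier modes. -/
lemma poincare {g : Cper L} {v : L2per L} (h : (g, v) ∈ DG L) (m : ℕ)
    (hm : ∀ k : ℤ, |k| ≤ m → inner ℂ (mode L k) (T L g) = 0) :
    2 * Real.pi / L * (m + 1) * ‖T L g‖ ≤ ‖v‖ := by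
  have hL0 := hL.out
  have hpi := Real.pi_pos
  refine le_of_sq_le_sq ?_ (norm_nonneg _)
  rw [mul_pow]
  refine hasSum_le (fun k => ?_) ((hasSum_norm_sq (T L g)).mul_left _) (hasSum_norm_sq v)
  rw [fbasis_repr, fbasis_repr, inner_mode_of_DG h]
  by_cases hk : |k| ≤ m
  · rw [hm k hk]
    simp
  · push Not at hk
    have hk' : (m : ℝ) + 1 ≤ |(k : ℝ)| := by
      have : (m : ℤ) + 1 ≤ |k| := hk
      exact_mod_cast this
    rw [norm_mul, norm_mul, norm_mul, norm_ik, ← mul_pow]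
    have h2 : 2 * Real.pi / L * (m + 1) ≤ 2 * Real.pi / L * |(k : ℝ)| := by gcongr
    refine pow_le_pow_left₀ (by positivity) ?_ 2
    calc _ ≤ 2 * Real.pi / L * |(k : ℝ)| * (‖((√L)⁻¹ : ℂ)‖ * ‖inner ℂ (mode L k) (T L g)‖) := by
          gcongr
      _ = _ := by ring

/-- Poincaré's inequality for derivatives. -/
lemma poincare_of_deriv {g h : Cper L} {v : L2per L} (hg : (g, T L h) ∈ DG L)
    (hh : (h, v) ∈ DG L) : 2 * Real.pi / L * ‖T L h‖ ≤ ‖v‖ := by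
  have := poincare hh 0 (by
    intro k hk
    have hk0 : k = 0 := by simpa using hk
    rw [hk0, inner_mode_of_DG hg]
    simp [ik])
  simpa using this

end

section

/-! ### Weakly differentiable functions are continuous -/

variable {L : ℝ} [hL : Fact (0 < L)]

lemma integral_mul_fourier_neg (k : ℤ) (w : L2per L) :
    ∫ x in (0 : ℝ)..L, w (x : AddCircle L) * fourier (-k) (x : AddCircle L) =
      inner ℂ (mode L k) w := by
  have := AddCircle.intervalIntegral_preimage L 0 (fun p => w p * fourier (-k) p)
  rw [zero_add] at this
  rw [this, inner_mode]

lemma inner_mode_of_hasWeakDeriv {u v : L2per L} (h : HasWeakDeriv u v) (k : ℤ) :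
    inner ℂ (mode L k) v = ik L k * inner ℂ (mode L k) u := by
  have h1 : ContDiff ℝ ∞ (fun x : ℝ => fourier (-k) (x : AddCircle L)) := by
    simp only [fourier_coe_apply]
    have : ContDiff ℝ ∞ (fun x : ℝ => (x : ℂ)) := Complex.ofRealCLM.contDiff
    fun_prop
  have h2 := h _ h1 (by intro x; simp)
  have h3 : deriv (fun x : ℝ => fourier (-k) (x : AddCircle L)) =
      fun x : ℝ => - ik L k * fourier (-k) (x : AddCircle L) := by
    ext x
    rw [(hasDerivAt_fourier_neg L k x).deriv, ik]
    ring
  rw [h3, integral_mul_fourier_neg] at h2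
  simp_rw [mul_left_comm _ (-ik L k)] at h2
  rw [intervalIntegral.integral_const_mul, integral_mul_fourier_neg] at h2
  linear_combination h2

/-- A function with a square integrable weak derivative is continuous: its Fourier coefficients are
absolutely summable, because `|û(k)| ≤ |k û(k)|² + |k|⁻²`. -/
lemma exists_DG_of_hasWeakDeriv {u v : L2per L} (h : HasWeakDeriv u v) :
    ∃ g : Cper L, T L g = u ∧ (g, v) ∈ DG L := by
  have hL0 := hL.out
  have hpi := Real.pi_pos
  set a : ℤ → ℂ := fun k => (fbasis L).repr u k with ha
  have hb (k : ℤ) : (fbasis L).repr v k = ik L k * a k := by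
    simp only [ha, fbasis_repr, inner_mode_of_hasWeakDeriv h]
    ring
  have hsum : Summable fun k => ‖a k‖ := by
    have h1 : Summable fun k : ℤ => ‖(fbasis L).repr v k‖ ^ 2 + (L / (2 * Real.pi)) ^ 2 *
        (1 / (k : ℝ) ^ 2) :=
      (hasSum_norm_sq v).summable.add
        ((Real.summable_one_div_int_pow.2 one_lt_two).mul_left _)
    refine Summable.of_norm_bounded_eventually h1 ?_
    have h2 : ∀ᶠ k : ℤ in cofinite, k ≠ 0 := by
      exact (Set.finite_singleton (0 : ℤ)).subset (fun k hk => by simpa using hk)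
    filter_upwards [h2] with k hk
    have hk' : 0 < |(k : ℝ)| := abs_pos.2 (by exact_mod_cast hk)
    rw [norm_norm, hb, norm_mul, norm_ik, ← sq_abs (k : ℝ)]
    set x := 2 * Real.pi / L * |(k : ℝ)| with hx
    have hx0 : 0 < x := by positivity
    have h3 : (L / (2 * Real.pi)) ^ 2 * (1 / |(k : ℝ)| ^ 2) = (x⁻¹) ^ 2 := by
      rw [hx]; field_simp
    rw [h3]
    have h4 : ‖a k‖ = (x * ‖a k‖) * x⁻¹ := by field_simp
    nlinarith [sq_nonneg (x * ‖a k‖ - x⁻¹), sq_nonneg (x * ‖a k‖), sq_nonneg x⁻¹]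
  have hs1 : Summable fun k => a k • (((√L)⁻¹ : ℂ) • (fourier k : Cper L)) := by
    apply Summable.of_norm
    simp_rw [norm_smul, fourier_norm]
    exact hsum.mul_right _
  obtain ⟨g, hg⟩ := hs1
  have hT : T L g = u := by
    refine ((T L).hasSum hg).unique ?_
    convert (fbasis L).hasSum_repr u using 1
    ext1 k
    simp only [map_smul, fbasis_apply, nmode, mode_eq]
    rfl
  refine ⟨g, hT, ?_⟩
  have hv := (fbasis L).hasSum_repr v
  have hp := hg.prodMk hv
  refine (Submodule.isClosed_topologicalClosure _).mem_of_tendsto hp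
    (Eventually.of_forall fun s => sum_mem fun k _ => ?_)
  have := (DG L).smul_mem (a k * (√L : ℂ)⁻¹) (fourier_mem_DG k)
  convert! this using 1
  rw [Prod.smul_mk, smul_smul, smul_smul, hb, fbasis_apply, nmode, smul_smul]
  congr 2
  ring

/-! ### Continuous representatives of the elements of `H²_per` -/

lemma exists_rep (u : H2per L) :
    ∃ p : Cper L × Cper L, T L p.1 = fn u ∧ (p.1, T L p.2) ∈ DG L ∧ (p.2, xx u) ∈ DG L := by
  obtain ⟨v, h1, h2⟩ := u.2
  obtain ⟨g, hg, hg'⟩ := exists_DG_of_hasWeakDeriv h1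
  obtain ⟨h, hh, hh'⟩ := exists_DG_of_hasWeakDeriv h2
  exact ⟨(g, h), hg, by rwa [hh], hh'⟩

lemma rep_unique {u : H2per L} {p q : Cper L × Cper L}
    (hp : T L p.1 = fn u ∧ (p.1, T L p.2) ∈ DG L ∧ (p.2, xx u) ∈ DG L)
    (hq : T L q.1 = fn u ∧ (q.1, T L q.2) ∈ DG L ∧ (q.2, xx u) ∈ DG L) : p = q := by
  have h1 : p.1 = q.1 := T_injective (hp.1.trans hq.1.symm)
  refine Prod.ext h1 (T_injective (DG_unique hp.2.1 ?_))
  rw [h1]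
  exact hq.2.1

lemma norm_sq_H2per (u : H2per L) : ‖u‖ ^ 2 = ‖fn u‖ ^ 2 + ‖xx u‖ ^ 2 :=
  WithLp.prod_norm_sq_eq_of_L2 u.1

lemma norm_fn_le (u : H2per L) : ‖fn u‖ ≤ ‖u‖ := by
  refine le_of_sq_le_sq ?_ (norm_nonneg _)
  rw [norm_sq_H2per]
  nlinarith [sq_nonneg ‖xx u‖]

lemma norm_xx_le (u : H2per L) : ‖xx u‖ ≤ ‖u‖ := by
  refine le_of_sq_le_sq ?_ (norm_nonneg _)
  rw [norm_sq_H2per]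
  nlinarith [sq_nonneg ‖fn u‖]

/-- The underlying function as a continuous linear map. -/
def fnL (L : ℝ) [Fact (0 < L)] : H2per L →L[ℂ] L2per L :=
  LinearMap.mkContinuous { toFun := fn, map_add' := fun _ _ => rfl, map_smul' := fun _ _ => rfl }
    1 (fun u => by rw [one_mul]; exact norm_fn_le u)

/-- The second derivative as a continuous linear map. -/
def xxL (L : ℝ) [Fact (0 < L)] : H2per L →L[ℂ] L2per L :=
  LinearMap.mkContinuous { toFun := xx, map_add' := fun _ _ => rfl, map_smul' := fun _ _ => rfl }
    1 (fun u => by rw [one_mul]; exact norm_xx_le u)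

/-- The continuous representatives of `u` and `u_x`. -/
def rep (L : ℝ) [Fact (0 < L)] : H2per L →ₗ[ℂ] Cper L × Cper L where
  toFun u := (exists_rep u).choose
  map_add' u w := by
    obtain ⟨a1, a2, a3⟩ := (exists_rep u).choose_spec
    obtain ⟨b1, b2, b3⟩ := (exists_rep w).choose_spec
    refine rep_unique (exists_rep (u + w)).choose_spec ⟨?_, ?_, add_mem a3 b3⟩
    · rw [Prod.fst_add, map_add, a1, b1]; rfl
    · rw [Prod.snd_add, map_add]; exact add_mem a2 b2
  map_smul' c u := by
    obtain ⟨a1, a2, a3⟩ := (exists_rep u).choose_spec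
    refine rep_unique (exists_rep (c • u)).choose_spec ⟨?_, ?_, (DG L).smul_mem c a3⟩
    · rw [RingHom.id_apply, Prod.smul_fst, map_smul, a1]; rfl
    · rw [RingHom.id_apply, Prod.smul_snd, map_smul]; exact (DG L).smul_mem c a2

lemma rep_spec (u : H2per L) : T L (rep L u).1 = fn u ∧ ((rep L u).1, T L (rep L u).2) ∈ DG L ∧
    ((rep L u).2, xx u) ∈ DG L := (exists_rep u).choose_spec

lemma norm_T_rep_snd_le (u : H2per L) : ‖T L (rep L u).2‖ ≤ L / (2 * Real.pi) * ‖u‖ := by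
  have hL0 := hL.out
  have hpi := Real.pi_pos
  have h1 := poincare_of_deriv (rep_spec u).2.1 (rep_spec u).2.2
  have h2 : ‖T L (rep L u).2‖ =
      L / (2 * Real.pi) * (2 * Real.pi / L * ‖T L (rep L u).2‖) := by field_simp
  rw [h2]
  gcongr
  exact h1.trans (norm_xx_le u)

/-- The continuous function underlying an element of `H²_per`. -/
def cf (L : ℝ) [Fact (0 < L)] : H2per L →L[ℂ] Cper L :=
  LinearMap.mkContinuous (LinearMap.fst ℂ _ _ ∘ₗ rep L) √(1 / L + 2 * (L / (2 * Real.pi)))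
    (fun u => by
      have hL0 := (inferInstance : Fact (0 < L)).out
      have hpi := Real.pi_pos
      refine le_of_sq_le_sq ?_ (by positivity)
      rw [mul_pow, Real.sq_sqrt (by positivity)]
      refine (agmon (rep_spec u).2.1).trans ?_
      rw [(rep_spec u).1, add_mul, div_mul_eq_mul_div, one_mul]
      have h1 := norm_fn_le u
      have h2 := norm_T_rep_snd_le u
      calc _ ≤ ‖u‖ ^ 2 / L + 2 * ‖u‖ * (L / (2 * Real.pi) * ‖u‖) := by gcongr
        _ = _ := by ring)

/-- The continuous function representing the derivative of an element of `H²_per`. -/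
def dx (L : ℝ) [Fact (0 < L)] : H2per L →L[ℂ] Cper L :=
  LinearMap.mkContinuous (LinearMap.snd ℂ _ _ ∘ₗ rep L)
    √((L / (2 * Real.pi)) ^ 2 / L + 2 * (L / (2 * Real.pi)))
    (fun u => by
      have hL0 := (inferInstance : Fact (0 < L)).out
      have hpi := Real.pi_pos
      refine le_of_sq_le_sq ?_ (by positivity)
      rw [mul_pow, Real.sq_sqrt (by positivity)]
      refine (agmon (rep_spec u).2.2).trans ?_
      have h1 := norm_xx_le u
      have h2 := norm_T_rep_snd_le u
      calc _ ≤ (L / (2 * Real.pi) * ‖u‖) ^ 2 / L + 2 * (L / (2 * Real.pi) * ‖u‖) * ‖u‖ := by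
            gcongr
        _ = _ := by ring)

lemma T_cf (u : H2per L) : T L (cf L u) = fn u := (rep_spec u).1
lemma cf_dx (u : H2per L) : (cf L u, T L (dx L u)) ∈ DG L := (rep_spec u).2.1
lemma dx_xx (u : H2per L) : (dx L u, xx u) ∈ DG L := (rep_spec u).2.2

/-- `∂_xx` is symmetric and `(u_xx, u) = -‖u_x‖²`. -/
lemma inner_xx (u w : H2per L) :
    inner ℝ (xx u) (fn w) = - inner ℝ (T L (dx L u)) (T L (dx L w)) := by
  rw [← T_cf, inner_parts (dx_xx u) (cf_dx w)]

lemma eq_of_fn_eq {u w : H2per L} (h : fn u = fn w) : u = w := by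
  have h1 : cf L u = cf L w := T_injective (by rw [T_cf, T_cf, h])
  have h2 : dx L u = dx L w := T_injective (DG_unique (cf_dx u) (by rw [h1]; exact cf_dx w))
  have h3 : xx u = xx w := DG_unique (dx_xx u) (by rw [h2]; exact dx_xx w)
  apply Subtype.ext
  exact (WithLp.ofLp_injective 2) (Prod.ext h h3)

end

section

/-! ### The equation as an evolution in `L²_per` -/

/-- Carathéodory's criterion for the derivative of a quantity whose increments are controlled
bilinearly by those of a differentiable curve. -/
lemma hasDerivAt_of_factor {E F G : Type*} [NormedAddCommGroup E] [NormedSpace ℝ E]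
    [NormedAddCommGroup F] [NormedSpace ℝ F] [NormedAddCommGroup G] [NormedSpace ℝ G]
    (B : G →L[ℝ] E →L[ℝ] F) {u : ℝ → E} {v : E} {Y : ℝ → G} {φ : ℝ → F} {t : ℝ}
    (hu : HasDerivAt u v t) (hY : ContinuousAt Y t)
    (h : ∀ s, φ s - φ t = B (Y s) (u s - u t)) : HasDerivAt φ (B (Y t) v) t := by
  rw [hasDerivAt_iff_tendsto_slope] at hu ⊢
  have h1 : slope φ t = fun s => B (Y s) (slope u t s) := by
    ext s
    rw [slope_def_module, slope_def_module, h, map_smul]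
  rw [h1]
  have h2 : Tendsto (fun s => B (Y s)) (𝓝[≠] t) (𝓝 (B (Y t))) :=
    (B.continuous.tendsto _).comp (hY.tendsto.mono_left nhdsWithin_le_nhds)
  exact ((isBoundedBilinearMap_apply (𝕜 := ℝ)).continuous.tendsto (B (Y t), v)).comp
    (h2.prodMk_nhds hu)

variable {L : ℝ} [hL : Fact (0 < L)]

lemma hasDerivAt_of_inner {u Y : ℝ → L2per L} {v : L2per L} {φ : ℝ → ℝ} {t : ℝ}
    (hu : HasDerivAt u v t) (hY : ContinuousAt Y t)
    (h : ∀ s, φ s - φ t = inner ℝ (Y s) (u s - u t)) : HasDerivAt φ (inner ℝ (Y t) v) t :=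
  hasDerivAt_of_factor (innerSL ℝ) hu hY h

lemma hasDerivAt_T_mul {a b : ℝ → Cper L} {a' b' : L2per L} {t : ℝ}
    (hb : ContinuousAt b t)
    (ha' : HasDerivAt (fun s => T L (a s)) a' t) (hb' : HasDerivAt (fun s => T L (b s)) b' t) :
    HasDerivAt (fun s => T L (a s * b s)) (M L (b t) a' + M L (a t) b') t := by
  have h1 : HasDerivAt (fun s => M L (b s) (T L (a s) - T L (a t))) (M L (b t) a') t :=
    hasDerivAt_of_factor (M L |>.bilinearRestrictScalars ℝ) ha' hb (by intro s; simp)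
  have h2 : HasDerivAt (fun s => M L (a t) (T L (b s))) (M L (a t) b') t :=
    ((M L (a t)).restrictScalars ℝ).hasFDerivAt.comp_hasDerivAt t hb'
  convert! h1.add h2 using 1
  ext1 s
  simp only [Pi.add_apply, map_sub, M_T]
  rw [mul_comm (b s), mul_comm (b s)]
  abel

lemma hasDerivAt_T_star {a : ℝ → Cper L} {a' : L2per L} {t : ℝ}
    (ha' : HasDerivAt (fun s => T L (a s)) a' t) :
    HasDerivAt (fun s => T L (star (a s))) (cj L a') t := by
  simp_rw [← cj_T]
  exact (cj L).hasFDerivAt.comp_hasDerivAt t ha'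

/-- The cubic nonlinearity `|g|² g`. -/
def nl (g : Cper L) : Cper L := star g * g * g

/-- The velocity `u_t` prescribed by the equation. -/
def vel (γ : ℝ) (f : L2per L) (u : H2per L) : L2per L :=
  Complex.I • (xx u + T L (nl (cf L u)) - f) - γ • fn u

lemma continuous_fn : Continuous (fn : H2per L → L2per L) := (fnL L).continuous
lemma continuous_xx : Continuous (xx : H2per L → L2per L) := (xxL L).continuous

lemma continuous_vel (γ : ℝ) (f : L2per L) : Continuous (vel γ f) := by
  have h1 := continuous_fn (L := L)
  have h2 := continuous_xx (L := L)
  unfold vel nl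
  fun_prop

lemma fn_sub (u w : H2per L) : fn (u - w) = fn u - fn w := rfl
lemma xx_sub (u w : H2per L) : xx (u - w) = xx u - xx w := rfl

lemma eq_vel {γ : ℝ} {f v : L2per L} {u : H2per L}
    (h : ∀ᵐ x : AddCircle L,
      Complex.I * v x + xx u x + (‖fn u x‖ : ℂ) ^ 2 * fn u x
        + Complex.I * (γ : ℂ) * fn u x = f x) : v = vel γ f u := by
  apply Lp.ext
  rw [vel]
  have hT := T_cf u
  filter_upwards [h, Lp.coeFn_sub (Complex.I • (xx u + T L (nl (cf L u)) - f)) (γ • fn u),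
    Lp.coeFn_smul Complex.I (xx u + T L (nl (cf L u)) - f), Lp.coeFn_smul γ (fn u),
    Lp.coeFn_sub (xx u + T L (nl (cf L u))) f, Lp.coeFn_add (xx u) (T L (nl (cf L u))),
    coeFn_T (nl (cf L u)), coeFn_T (cf L u)] with x h0 h1 h2 h3 h4 h5 h6 h7
  rw [hT] at h7
  rw [h1, Pi.sub_apply, h2, h3, Pi.smul_apply, Pi.smul_apply, h4, Pi.sub_apply, h5, Pi.add_apply,
    h6, nl, ContinuousMap.mul_apply, ContinuousMap.mul_apply, ContinuousMap.star_apply, ← h7, ← h0,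
    Complex.real_smul, smul_eq_mul]
  rw [← Complex.conj_mul', starRingEnd_apply]
  linear_combination ((v x) + γ * fn u x) * Complex.I_sq

/-- `u` is continuous at `t` in `H²_per` and satisfies the equation at `t` in `L²_per`. -/
structure SolvesAt (γ : ℝ) (f : L2per L) (u : ℝ → H2per L) (t : ℝ) : Prop where
  cont : ContinuousAt u t
  deriv : HasDerivAt (fun s => fn (u s)) (vel γ f (u t)) t

lemma IsSolutionOn.solvesAt {γ : ℝ} {f : L2per L} {J : Set ℝ} {u : ℝ → H2per L}
    (h : IsSolutionOn γ f J u) {t : ℝ} (ht : J ∈ 𝓝 t) : SolvesAt γ f u t := by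
  refine ⟨h.1.continuousAt ht, ?_⟩
  obtain ⟨v, hv, hv'⟩ := h.2 t (mem_of_mem_nhds ht)
  rw [← eq_vel hv']
  exact hv.hasDerivAt ht

/-- `‖w_x‖²` is differentiable although `w_x` need not be, since its increments are
`-(w_xx(s) + w_xx(t), w(s) - w(t))`. -/
lemma hasDerivAt_norm_dx_sq {w : ℝ → H2per L} {d : L2per L} {t : ℝ} (hc : ContinuousAt w t)
    (hd : HasDerivAt (fun s => fn (w s)) d t) :
    HasDerivAt (fun s => ‖T L (dx L (w s))‖ ^ 2) (-2 * inner ℝ (xx (w t)) d) t := by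
  have hx : ContinuousAt (fun s => xx (w s)) t := continuous_xx.continuousAt.comp hc
  have h := hasDerivAt_of_inner (φ := fun s => ‖T L (dx L (w s))‖ ^ 2)
    (Y := fun s => -(xx (w s) + xx (w t))) hd (hx.add continuousAt_const).neg (by
      intro s
      simp only [inner_neg_left, inner_add_left, inner_sub_right, inner_xx,
        ← real_inner_self_eq_norm_sq, real_inner_comm (T L (dx L (w t))) (T L (dx L (w s)))]
      ring)
  convert! h using 1
  rw [inner_neg_left, inner_add_left]
  ring

/-! ### Differences of solutions -/

/-- Twice the coefficient of `a - b` in `|a|² a - |b|² b`, that is `|a + b|²`. -/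
def pp (a b : Cper L) : Cper L := star (a + b) * (a + b)

/-- Twice the coefficient of the conjugate of `a - b` in `|a|² a - |b|² b`, that is `a² + b²`. -/
def qq (a b : Cper L) : Cper L := a * a + b * b

lemma nl_sub (a b : Cper L) :
    nl a - nl b = (2⁻¹ : ℝ) • (pp a b * (a - b) + qq a b * star (a - b)) := by
  ext x
  simp only [nl, pp, qq, ContinuousMap.sub_apply, ContinuousMap.mul_apply, ContinuousMap.add_apply,
    ContinuousMap.star_apply, ContinuousMap.smul_apply, star_add, star_sub, Complex.real_smul]
  push_cast
  ring

lemma T_smul (c : ℝ) (g : Cper L) : T L (c • g) = c • T L g :=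
  (T L).map_smul_of_tower c g

lemma vel_sub (γ : ℝ) (f : L2per L) (u w : H2per L) :
    vel γ f u - vel γ f w = Complex.I • (xx (u - w) +
      (2⁻¹ : ℝ) • (T L (pp (cf L u) (cf L w) * cf L (u - w)) +
        T L (qq (cf L u) (cf L w) * star (cf L (u - w))))) - γ • fn (u - w) := by
  have h := congrArg (T L) (nl_sub (cf L u) (cf L w))
  rw [map_sub, T_smul, map_add, ← map_sub (cf L)] at h
  rw [← h, vel, vel, fn_sub, xx_sub]
  module

lemma SolvesAt.sub_deriv {γ : ℝ} {f : L2per L} {u w : ℝ → H2per L} {t : ℝ}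
    (hu : SolvesAt γ f u t) (hw : SolvesAt γ f w t) :
    HasDerivAt (fun s => fn (u s - w s)) (vel γ f (u t) - vel γ f (w t)) t :=
  hu.deriv.sub hw.deriv

lemma inner_xx_I (u : H2per L) : inner ℝ (fn u) (Complex.I • xx u) = 0 := by
  have h1 : (Complex.I • dx L u, Complex.I • xx u) ∈ DG L :=
    (DG L).smul_mem Complex.I (dx_xx u)
  rw [real_inner_comm, ← T_cf, inner_parts h1 (cf_dx u), map_smul, real_inner_comm,
    inner_I_smul_self, neg_zero]

lemma star_pp (a b : Cper L) : star (pp a b) = pp a b := by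
  simp [pp, mul_comm]

lemma inner_I_real_mul {p : Cper L} (hp : star p = p) (w : L2per L) :
    inner ℝ w (Complex.I • M L p w) = 0 := by
  have h1 := inner_I_smul_left (M L p w) w
  have h2 := inner_M_left p w (Complex.I • w)
  have h3 := real_inner_comm (Complex.I • M L p w) w
  rw [hp, map_smul] at h2
  linarith

lemma SolvesAt.hasDerivAt_norm_sub_sq {γ : ℝ} {f : L2per L} {u w : ℝ → H2per L} {t : ℝ}
    (hu : SolvesAt γ f u t) (hw : SolvesAt γ f w t) :
    HasDerivAt (fun s => ‖fn (u s - w s)‖ ^ 2)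
      (inner ℝ (fn (u t - w t)) (Complex.I • M L (qq (cf L (u t)) (cf L (w t)))
        (cj L (fn (u t - w t)))) - 2 * γ * ‖fn (u t - w t)‖ ^ 2) t := by
  have h := (hu.sub_deriv hw).norm_sq
  convert! h using 1
  rw [vel_sub]
  set δ := u t - w t
  have h1 : T L (pp (cf L (u t)) (cf L (w t)) * cf L δ) =
      M L (pp (cf L (u t)) (cf L (w t))) (fn δ) := by rw [← T_cf, M_T]
  have h2 : T L (qq (cf L (u t)) (cf L (w t)) * star (cf L δ)) =
      M L (qq (cf L (u t)) (cf L (w t))) (cj L (fn δ)) := by rw [← T_cf, cj_T, M_T]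
  rw [h1, h2, inner_sub_right, smul_add, inner_add_right, inner_xx_I, smul_comm Complex.I,
    real_inner_smul_right, smul_add, inner_add_right, inner_I_real_mul (star_pp _ _),
    real_inner_smul_right, real_inner_self_eq_norm_sq]
  ring

end

section

variable {L : ℝ} [hL : Fact (0 < L)]

lemma SolvesAt.contCf {γ : ℝ} {f : L2per L} {u : ℝ → H2per L} {t : ℝ}
    (hu : SolvesAt γ f u t) : ContinuousAt (fun s => cf L (u s)) t :=
  (cf L).continuous.continuousAt.comp hu.cont

lemma SolvesAt.contDx {γ : ℝ} {f : L2per L} {u : ℝ → H2per L} {t : ℝ}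
    (hu : SolvesAt γ f u t) : ContinuousAt (fun s => dx L (u s)) t :=
  (dx L).continuous.continuousAt.comp hu.cont

lemma SolvesAt.contXx {γ : ℝ} {f : L2per L} {u : ℝ → H2per L} {t : ℝ}
    (hu : SolvesAt γ f u t) : ContinuousAt (fun s => xx (u s)) t :=
  continuous_xx.continuousAt.comp hu.cont

lemma SolvesAt.derivCf {γ : ℝ} {f : L2per L} {u : ℝ → H2per L} {t : ℝ}
    (hu : SolvesAt γ f u t) : HasDerivAt (fun s => T L (cf L (u s))) (vel γ f (u t)) t := by
  simp_rw [T_cf]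
  exact hu.deriv

/-- The energy `‖δ_x‖² - ½ ∫ (|u + w|² |δ|² + Re ((ū² + w̄²) δ²))` of a difference `δ = u - w`: the
quadratic form that the linear equation satisfied by `δ` would conserve if its coefficients did not
depend on time. -/
def diffEnergy (u w : H2per L) : ℝ :=
  ‖T L (dx L (u - w))‖ ^ 2 - 2⁻¹ *
    (inner ℝ (T L (pp (cf L u) (cf L w))) (T L (star (cf L (u - w)) * cf L (u - w))) +
      inner ℝ (T L (qq (cf L u) (cf L w))) (T L (cf L (u - w) * cf L (u - w))))

lemma norm_T_mul_le (a b : Cper L) : ‖T L (a * b)‖ ≤ ‖a‖ * ‖T L b‖ := by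
  rw [← M_T]
  exact norm_M_le a (T L b)

lemma abs_inner_le {a b : L2per L} {x y : ℝ} (ha : ‖a‖ ≤ x) (hb : ‖b‖ ≤ y) :
    |inner ℝ a b| ≤ x * y :=
  (abs_real_inner_le_norm a b).trans (by
    have := norm_nonneg a; have := norm_nonneg b; gcongr; linarith)

/-- The energy of a difference decays at the rate `2γ` up to a remainder that contains the time
derivatives of the coefficients only. -/
lemma SolvesAt.hasDerivAt_diffEnergy {γ : ℝ} {f : L2per L} {u w : ℝ → H2per L} {t m V : ℝ}
    (hu : SolvesAt γ f u t) (hw : SolvesAt γ f w t) (hum : ‖cf L (u t)‖ ≤ m)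
    (hwm : ‖cf L (w t)‖ ≤ m) (huV : ‖vel γ f (u t)‖ ≤ V) (hwV : ‖vel γ f (w t)‖ ≤ V) :
    ∃ r, HasDerivAt (fun s => diffEnergy (u s) (w s))
      (-(2 * γ) * diffEnergy (u t) (w t) + r) t ∧
      |r| ≤ 6 * m * V * (‖cf L (u t - w t)‖ * ‖fn (u t - w t)‖) := by
  set δ := u t - w t with hδ
  set d := vel γ f (u t) - vel γ f (w t) with hd
  have cδ : ContinuousAt (fun s => cf L (u s - w s)) t :=
    (cf L).continuous.continuousAt.comp (hu.cont.sub hw.cont)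
  have dδ : HasDerivAt (fun s => T L (cf L (u s - w s))) d t := by
    simp_rw [T_cf]; exact hu.sub_deriv hw
  have dE := hasDerivAt_T_mul cδ (hasDerivAt_T_star dδ) dδ
  have dK := hasDerivAt_T_mul cδ dδ dδ
  have cs : ContinuousAt (fun s => cf L (u s) + cf L (w s)) t := hu.contCf.add hw.contCf
  have ds : HasDerivAt (fun s => T L (cf L (u s) + cf L (w s)))
      (vel γ f (u t) + vel γ f (w t)) t := by
    simp_rw [map_add]
    exact hu.derivCf.add hw.derivCf
  have dP := hasDerivAt_T_mul cs (hasDerivAt_T_star ds) ds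
  have dQ := (hasDerivAt_T_mul hu.contCf hu.derivCf hu.derivCf).add
    (hasDerivAt_T_mul hw.contCf hw.derivCf hw.derivCf)
  have dQ' := dQ.congr_of_eventuallyEq
    (f₁ := fun s => T L (qq (cf L (u s)) (cf L (w s))))
    (Eventually.of_forall fun s => by simp [qq, map_add])
  have dN := hasDerivAt_norm_dx_sq (hu.cont.sub hw.cont) (hu.sub_deriv hw)
  have dAll := dN.sub (((dP.inner ℝ dE).add (dQ'.inner ℝ dK)).const_mul 2⁻¹)
  set s := cf L (u t) + cf L (w t) with hs
  set P' := M L s (cj L (vel γ f (u t) + vel γ f (w t))) +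
    M L (star s) (vel γ f (u t) + vel γ f (w t)) with hP'
  set Q' := M L (cf L (u t)) (vel γ f (u t)) + M L (cf L (u t)) (vel γ f (u t)) +
    (M L (cf L (w t)) (vel γ f (w t)) + M L (cf L (w t)) (vel γ f (w t))) with hQ'
  refine ⟨-2⁻¹ * (inner ℝ P' (T L (star (cf L δ) * cf L δ)) +
    inner ℝ Q' (T L (cf L δ * cf L δ))), ?_, ?_⟩
  · convert! dAll using 1
    have e1 : inner ℝ (T L (star s * s)) (M L (cf L δ) (cj L d) + M L (star (cf L δ)) d) =
        2 * inner ℝ (T L (pp (cf L (u t)) (cf L (w t)) * cf L δ)) d := by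
      rw [inner_add_right, ← star_star (cf L δ), ← inner_M_left, star_star, M_T,
        ← inner_M_left, M_T, ← inner_cj_cj, cj_T, cj_cj, pp]
      simp only [star_mul, star_star, hs]
      rw [mul_comm (star _) (cf L (u t) + cf L (w t)),
        mul_comm (cf L δ)]
      ring_nf
    have e2 : inner ℝ (T L (qq (cf L (u t)) (cf L (w t)))) (M L (cf L δ) d + M L (cf L δ) d) =
        2 * inner ℝ (T L (qq (cf L (u t)) (cf L (w t)) * star (cf L δ))) d := by
      rw [inner_add_right, ← star_star (cf L δ), ← inner_M_left, star_star, M_T, mul_comm]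
      ring
    have e3 : inner ℝ (T L (pp (cf L (u t)) (cf L (w t)) * cf L δ)) (fn δ) =
        inner ℝ (T L (pp (cf L (u t)) (cf L (w t)))) (T L (star (cf L δ) * cf L δ)) := by
      rw [mul_comm, ← M_T, inner_M_left, ← T_cf, M_T]
    have e4 : inner ℝ (T L (qq (cf L (u t)) (cf L (w t)) * star (cf L δ))) (fn δ) =
        inner ℝ (T L (qq (cf L (u t)) (cf L (w t)))) (T L (cf L δ * cf L δ)) := by
      rw [mul_comm, ← M_T, inner_M_left, star_star, ← T_cf, M_T]
    set W := xx δ + (2⁻¹ : ℝ) • (T L (pp (cf L (u t)) (cf L (w t)) * cf L δ) +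
      T L (qq (cf L (u t)) (cf L (w t)) * star (cf L δ))) with hW
    have e5 : inner ℝ W d = - γ * inner ℝ W (fn δ) := by
      rw [hd, vel_sub, inner_sub_right, inner_I_smul_self, real_inner_smul_right]
      ring
    have e6 : inner ℝ W d = inner ℝ (xx δ) d + 2⁻¹ *
        (inner ℝ (T L (pp (cf L (u t)) (cf L (w t)) * cf L δ)) d +
          inner ℝ (T L (qq (cf L (u t)) (cf L (w t)) * star (cf L δ))) d) := by
      rw [hW, inner_add_left, real_inner_smul_left, inner_add_left]
    have e7 : inner ℝ W (fn δ) = - diffEnergy (u t) (w t) := by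
      rw [hW, inner_add_left, real_inner_smul_left, inner_add_left, e3, e4, inner_xx,
        real_inner_self_eq_norm_sq, diffEnergy]
      ring
    rw [e7] at e5
    change _ = -2 * inner ℝ (xx δ) d - 2⁻¹ * (inner ℝ (T L (star s * s)) _ + _ +
      (inner ℝ (T L (qq (cf L (u t)) (cf L (w t)))) _ + _))
    rw [e1, e2]
    linear_combination 2 * e5 - 2 * e6
  · have hm0 : 0 ≤ m := (norm_nonneg _).trans hum
    have hV0 : 0 ≤ V := (norm_nonneg _).trans huV
    have hs2 : ‖s‖ ≤ 2 * m := (norm_add_le _ _).trans (by linarith)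
    have hv2 : ‖vel γ f (u t) + vel γ f (w t)‖ ≤ 2 * V := (norm_add_le _ _).trans (by linarith)
    have hMP (a : Cper L) (b : L2per L) {x y : ℝ} (hx : ‖a‖ ≤ x) (hy : ‖b‖ ≤ y) :
        ‖M L a b‖ ≤ x * y := (norm_M_le a b).trans (by
          have := norm_nonneg a; have := norm_nonneg b; gcongr; linarith)
    have hP2 : ‖P'‖ ≤ 2 * m * (2 * V) + 2 * m * (2 * V) :=
      norm_add_le_of_le (hMP _ _ hs2 (by rwa [norm_cj])) (hMP _ _ (by rwa [norm_star]) hv2)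
    have hQ2 : ‖Q'‖ ≤ m * V + m * V + (m * V + m * V) :=
      norm_add_le_of_le (norm_add_le_of_le (hMP _ _ hum huV) (hMP _ _ hum huV))
        (norm_add_le_of_le (hMP _ _ hwm hwV) (hMP _ _ hwm hwV))
    have h1 : ‖T L (star (cf L δ) * cf L δ)‖ ≤ ‖cf L δ‖ * ‖fn δ‖ := by
      rw [← T_cf δ, ← norm_star (cf L δ)]
      exact norm_T_mul_le _ _
    have h2 : ‖T L (cf L δ * cf L δ)‖ ≤ ‖cf L δ‖ * ‖fn δ‖ := by
      rw [← T_cf δ]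
      exact norm_T_mul_le _ _
    have i1 := abs_le.1 (abs_inner_le hP2 h1)
    have i2 := abs_le.1 (abs_inner_le hQ2 h2)
    rw [abs_le]
    constructor <;> linarith [i1.1, i1.2, i2.1, i2.2]

/-! ### The corrector of the second order energy -/

/-- The functional `Re ∫ ū² u_x²`. Its time derivative contains the term `-2 Im ∫ ū² u_t²`, which is
quadratic in `u_t` and cancels the uncontrolled term in the time derivative of `‖u_t‖²`. -/
def corr (u : H2per L) : ℝ :=
  inner ℝ (T L (cf L u * cf L u)) (T L (dx L u * dx L u))

/-- Only `u`, not `u_x`, is differentiable in time: the increment of `u_x²` is integrated by parts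
before the limit is taken. -/
lemma SolvesAt.hasDerivAt_corr {γ : ℝ} {f : L2per L} {u : ℝ → H2per L} {t : ℝ}
    (hu : SolvesAt γ f u t) :
    HasDerivAt (fun s => corr (u s))
      (2 * inner ℝ (vel γ f (u t)) (T L (star (cf L (u t)) * (dx L (u t) * dx L (u t))))
        - 2 * inner ℝ (vel γ f (u t)) (M L (cf L (u t) * cf L (u t)) (cj L (xx (u t))))
        - 4 * inner ℝ (vel γ f (u t))
          (T L (cf L (u t) * (dx L (u t) * star (dx L (u t)))))) t := by
  have ca := hu.contCf
  have cg := hu.contDx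
  have cx := hu.contXx
  have da2 := hasDerivAt_T_mul ca hu.derivCf hu.derivCf
  have h1 : HasDerivAt (fun s => inner ℝ (T L (dx L (u s) * dx L (u s)))
      (T L (cf L (u s) * cf L (u s)) - T L (cf L (u t) * cf L (u t)))) _ t :=
    hasDerivAt_of_inner (Y := fun s => T L (dx L (u s) * dx L (u s))) da2
      ((T L).continuous.continuousAt.comp (cg.mul cg)) (by intro s; simp)
  -- With `a = u(t)`: `∫ ā² (g_s² - g_t²) = -∫ (ā² (g_s + g_t))_x (u(s) - u(t))` for `g = u_x`.
  have h2 := hasDerivAt_of_inner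
    (φ := fun s => inner ℝ (T L (cf L (u t) * cf L (u t))) (T L (dx L (u s) * dx L (u s))))
    (Y := fun s => -(M L (cf L (u t) * cf L (u t)) (cj L (xx (u s) + xx (u t))) +
      M L (star (dx L (u s) + dx L (u t))) (M L (cf L (u t)) (T L (dx L (u t))) +
        M L (cf L (u t)) (T L (dx L (u t)))))) hu.derivCf (by fun_prop) (by
      intro s
      have k0 : (dx L (u s) + dx L (u t), xx (u s) + xx (u t)) ∈ DG L :=
        add_mem (dx_xx (u s)) (dx_xx (u t))
      have k1 : (cf L (u s) - cf L (u t), T L (dx L (u s)) - T L (dx L (u t))) ∈ DG L :=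
        sub_mem (cf_dx (u s)) (cf_dx (u t))
      have k2 := inner_parts (DG_mul (DG_mul (cf_dx (u t)) (cf_dx (u t))) (DG_star k0)) k1
      rw [inner_neg_left, ← map_sub, k2, neg_neg,
        mul_comm _ (star _), ← M_T (star _), inner_M_left, star_star,
        ← map_sub, M_T, ← inner_sub_right, ← map_sub]
      congr 2
      ring)
  have h := h1.add h2
  convert! h using 1
  · ext s
    simp only [corr, Pi.add_apply, inner_sub_right]
    rw [real_inner_comm (T L (dx L (u s) * dx L (u s))),
      real_inner_comm (T L (cf L (u t) * cf L (u t))) (T L (dx L (u s) * dx L (u s)))]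
    ring
  · have f1 : inner ℝ (T L (dx L (u t) * dx L (u t))) (M L (cf L (u t)) (vel γ f (u t))) =
        inner ℝ (vel γ f (u t)) (T L (star (cf L (u t)) * (dx L (u t) * dx L (u t)))) := by
      rw [real_inner_comm, inner_M_left, M_T]
    have f2 : inner ℝ (M L (cf L (u t) * cf L (u t)) (cj L (xx (u t) + xx (u t))))
        (vel γ f (u t)) = 2 * inner ℝ (vel γ f (u t))
          (M L (cf L (u t) * cf L (u t)) (cj L (xx (u t)))) := by
      rw [map_add, map_add, inner_add_left, real_inner_comm]
      ring
    have f3 : inner ℝ (M L (star (dx L (u t) + dx L (u t))) (M L (cf L (u t)) (T L (dx L (u t))) +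
        M L (cf L (u t)) (T L (dx L (u t))))) (vel γ f (u t)) = 4 * inner ℝ (vel γ f (u t))
          (T L (cf L (u t) * (dx L (u t) * star (dx L (u t))))) := by
      simp only [star_add, map_add, add_apply, M_T, inner_add_left]
      rw [real_inner_comm, mul_comm (star _), mul_assoc]
      ring
    rw [inner_neg_left, inner_add_left, inner_add_right, f1, f2, f3]
    ring

end

section

/-! ### The norm of the velocity -/

variable {L : ℝ} [hL : Fact (0 < L)]

/-- A continuously differentiable curve has jointly convergent difference quotients. -/
lemma tendsto_diff_quot {E : Type*} [NormedAddCommGroup E] [NormedSpace ℝ E] {F F' : ℝ → E} {t : ℝ}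
    (h : ∀ᶠ s in 𝓝 t, HasDerivAt F (F' s) s) (hc : ContinuousAt F' t) :
    Tendsto (fun p : ℝ × ℝ => p.1⁻¹ • (F (p.2 + p.1) - F p.2)) (𝓝[≠] 0 ×ˢ 𝓝 t) (𝓝 (F' t)) := by
  have h1 := (hasStrictDerivAt_of_hasDerivAt_of_continuousAt h hc).isLittleO
  have h2 : Tendsto (fun p : ℝ × ℝ => (p.2 + p.1, p.2)) (𝓝[≠] 0 ×ˢ 𝓝 t) (𝓝 (t, t)) := by
    have h3 : Tendsto (fun p : ℝ × ℝ => (p.2 + p.1, p.2)) (𝓝 (0, t)) (𝓝 (t + 0, t)) :=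
      Continuous.tendsto (by fun_prop) (0, t)
    rw [add_zero, nhds_prod_eq] at h3
    exact h3.mono_left (Filter.prod_mono nhdsWithin_le_nhds le_rfl)
  have h4 := (h1.comp_tendsto h2).tendsto_inv_smul_nhds_zero
  have h5 : Tendsto (fun _ : ℝ × ℝ => F' t) (𝓝[≠] 0 ×ˢ 𝓝 t) (𝓝 (F' t)) := tendsto_const_nhds
  have h6 := h4.add h5
  rw [zero_add] at h6
  refine h6.congr' ?_
  have h7 : ∀ᶠ p : ℝ × ℝ in 𝓝[≠] 0 ×ˢ 𝓝 t, p.1 ≠ 0 :=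
    tendsto_fst.eventually eventually_mem_nhdsWithin
  filter_upwards [h7] with p hp
  simp [smul_sub, smul_smul, hp]

/-- The velocity `v = u_t` need not be differentiable in time, but `‖v‖²` is: the identity is the
limit of the one for `‖u(t + h) - u(t)‖² / h²`, locally uniformly in `t`. -/
lemma hasDerivAt_norm_vel_sq {γ : ℝ} {f : L2per L} {u : ℝ → H2per L} {t : ℝ}
    (h : ∀ᶠ s in 𝓝 t, SolvesAt γ f u s) :
    HasDerivAt (fun s => ‖vel γ f (u s)‖ ^ 2)
      (2 * inner ℝ (vel γ f (u t)) (Complex.I • M L (cf L (u t) * cf L (u t))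
        (cj L (vel γ f (u t)))) - 2 * γ * ‖vel γ f (u t)‖ ^ 2) t := by
  have hcu : ContinuousAt u t := h.self_of_nhds.cont
  have hv : ContinuousAt (fun s => vel γ f (u s)) t := (continuous_vel γ f).continuousAt.comp hcu
  have ha : ContinuousAt (fun s => cf L (u s)) t := h.self_of_nhds.contCf
  set Q : ℝ × ℝ → L2per L := fun p => p.1⁻¹ • (fn (u (p.2 + p.1)) - fn (u p.2)) with hQ
  have hQ1 : Tendsto Q (𝓝[≠] 0 ×ˢ 𝓝 t) (𝓝 (vel γ f (u t))) :=
    tendsto_diff_quot (F := fun s => fn (u s)) (F' := fun s => vel γ f (u s))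
      (h.mono fun s hs => hs.deriv) hv
  have hsum : Tendsto (fun p : ℝ × ℝ => p.2 + p.1) (𝓝[≠] 0 ×ˢ 𝓝 t) (𝓝 t) := by
    have h3 : Tendsto (fun p : ℝ × ℝ => p.2 + p.1) (𝓝 (0, t)) (𝓝 (t + 0)) :=
      Continuous.tendsto (by fun_prop) (0, t)
    rw [add_zero, nhds_prod_eq] at h3
    exact h3.mono_left (Filter.prod_mono nhdsWithin_le_nhds le_rfl)
  set R : L2per L → Cper L → ℝ := fun z q =>
    inner ℝ z (Complex.I • M L q (cj L z)) - 2 * γ * ‖z‖ ^ 2 with hR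
  have hRc : Continuous fun p : L2per L × Cper L => R p.1 p.2 := by
    simp only [hR]; fun_prop
  have hq : Tendsto (fun p : ℝ × ℝ => qq (cf L (u (p.2 + p.1))) (cf L (u p.2)))
      (𝓝[≠] 0 ×ˢ 𝓝 t) (𝓝 (qq (cf L (u t)) (cf L (u t)))) := by
    have h1 : Tendsto (fun p : ℝ × ℝ => cf L (u (p.2 + p.1))) (𝓝[≠] 0 ×ˢ 𝓝 t)
      (𝓝 (cf L (u t))) := ha.tendsto.comp hsum
    have h2 : Tendsto (fun p : ℝ × ℝ => cf L (u p.2)) (𝓝[≠] 0 ×ˢ 𝓝 t)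
      (𝓝 (cf L (u t))) := ha.tendsto.comp tendsto_snd
    exact (h1.mul h1).add (h2.mul h2)
  have hval : R (vel γ f (u t)) (qq (cf L (u t)) (cf L (u t))) =
      2 * inner ℝ (vel γ f (u t)) (Complex.I • M L (cf L (u t) * cf L (u t))
        (cj L (vel γ f (u t)))) - 2 * γ * ‖vel γ f (u t)‖ ^ 2 := by
    simp only [hR, qq]
    rw [map_add, add_apply, smul_add, inner_add_right]
    ring
  rw [← hval]
  refine hasDerivAt_of_tendstoUniformlyOnFilter (l := 𝓝[≠] (0 : ℝ))
    (f := fun e s => ‖Q (e, s)‖ ^ 2)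
    (f' := fun e s => R (Q (e, s)) (qq (cf L (u (s + e))) (cf L (u s))))
    (g' := fun s => R (vel γ f (u s)) (qq (cf L (u s)) (cf L (u s)))) ?_ ?_ ?_
  · rw [tendstoUniformlyOnFilter_iff_tendsto]
    have h1 : Tendsto (fun p : ℝ × ℝ => R (Q p) (qq (cf L (u (p.2 + p.1))) (cf L (u p.2))))
        (𝓝[≠] 0 ×ˢ 𝓝 t) (𝓝 (R (vel γ f (u t)) (qq (cf L (u t)) (cf L (u t))))) :=
      Tendsto.comp (g := fun z : L2per L × Cper L => R z.1 z.2)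
        (f := fun p : ℝ × ℝ => (Q p, qq (cf L (u (p.2 + p.1))) (cf L (u p.2))))
        (hRc.tendsto (vel γ f (u t), qq (cf L (u t)) (cf L (u t)))) (hQ1.prodMk_nhds hq)
    have h2 : ContinuousAt (fun s => R (vel γ f (u s)) (qq (cf L (u s)) (cf L (u s)))) t := by
      have : ContinuousAt (fun s => qq (cf L (u s)) (cf L (u s))) t := (ha.mul ha).add (ha.mul ha)
      exact ContinuousAt.comp (g := fun z : L2per L × Cper L => R z.1 z.2)
        (f := fun s => (vel γ f (u s), qq (cf L (u s)) (cf L (u s))))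
        hRc.continuousAt (hv.prodMk this)
    exact ((h2.tendsto.comp tendsto_snd).prodMk_nhds h1).mono_right (nhds_le_uniformity _)
  · have h1 : ∀ᶠ p : ℝ × ℝ in 𝓝[≠] 0 ×ˢ 𝓝 t, SolvesAt γ f u (p.2 + p.1) := hsum.eventually h
    have h2 : ∀ᶠ p : ℝ × ℝ in 𝓝[≠] 0 ×ˢ 𝓝 t, SolvesAt γ f u p.2 := tendsto_snd.eventually h
    filter_upwards [h1, h2] with p hp1 hp2
    have hs : SolvesAt γ f (fun s => u (s + p.1)) p.2 := by
      refine ⟨ContinuousAt.comp (f := fun s => s + p.1) hp1.cont (by fun_prop), ?_⟩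
      exact hp1.deriv.comp_add_const p.2 p.1
    have h3 := (hs.hasDerivAt_norm_sub_sq hp2).const_mul (p.1⁻¹ ^ 2)
    have hn (z : L2per L) : ‖p.1⁻¹ • z‖ ^ 2 = p.1⁻¹ ^ 2 * ‖z‖ ^ 2 := by
      rw [norm_smul, mul_pow, Real.norm_eq_abs, sq_abs]
    have hr (z : L2per L) (q : Cper L) : R (p.1⁻¹ • z) q = p.1⁻¹ ^ 2 * R z q := by
      simp only [hR]
      rw [hn, map_smul, (M L q).map_smul_of_tower, smul_comm Complex.I, real_inner_smul_left,
        real_inner_smul_right]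
      ring
    have e1 : (fun s => ‖Q (p.1, s)‖ ^ 2) =
        fun s => p.1⁻¹ ^ 2 * ‖fn (u (s + p.1) - u s)‖ ^ 2 := by
      ext s
      rw [fn_sub, ← hn]
    have e2 : R (Q (p.1, p.2)) (qq (cf L (u (p.2 + p.1))) (cf L (u p.2))) =
        p.1⁻¹ ^ 2 * R (fn (u (p.2 + p.1) - u p.2))
          (qq (cf L (u (p.2 + p.1))) (cf L (u p.2))) := by
      rw [← hr, fn_sub]
    rw [e1, e2]
    exact h3
  · filter_upwards [h] with s hs
    exact ((hasDerivAt_iff_tendsto_slope_zero.1 hs.deriv).norm).pow 2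

/-! ### The energy -/

/-- The energy functional of the equation. -/
def energy (f : L2per L) (u : H2per L) : ℝ :=
  ‖T L (dx L u)‖ ^ 2 - 2⁻¹ * ‖T L (star (cf L u) * cf L u)‖ ^ 2 + 2 * inner ℝ f (fn u)

lemma SolvesAt.hasDerivAt_energy {γ : ℝ} {f : L2per L} {u : ℝ → H2per L} {t : ℝ}
    (hu : SolvesAt γ f u t) :
    HasDerivAt (fun s => energy f (u s)) (-(2 * γ) * energy f (u t) + 2 * γ *
      (2⁻¹ * ‖T L (star (cf L (u t)) * cf L (u t))‖ ^ 2 + inner ℝ f (fn (u t)))) t := by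
  have d1 := hasDerivAt_norm_dx_sq hu.cont hu.deriv
  have d2 := (hasDerivAt_T_mul hu.contCf (hasDerivAt_T_star hu.derivCf) hu.derivCf).norm_sq
  have d3 := (hasDerivAt_const t f).inner ℝ hu.deriv
  convert! (d1.sub (d2.const_mul 2⁻¹)).add (d3.const_mul 2) using 1
  set a := cf L (u t) with ha
  set v := vel γ f (u t) with hv
  have e1 : inner ℝ (T L (star a * a)) (M L a (cj L v) + M L (star a) v) =
      2 * inner ℝ (T L (nl a)) v := by
    rw [inner_add_right, ← star_star a, ← inner_M_left, star_star, M_T,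
      ← inner_M_left, M_T, ← inner_cj_cj, cj_T, cj_cj]
    simp only [star_mul, star_star, nl]
    rw [mul_comm a (star a * a)]
    ring
  have e2 : inner ℝ (T L (nl a)) (fn (u t)) = ‖T L (star a * a)‖ ^ 2 := by
    rw [← T_cf, ← ha, ← real_inner_self_eq_norm_sq, nl, mul_comm, ← M_T, inner_M_left, M_T]
  have e3 : inner ℝ (xx (u t) + T L (nl a) - f) v =
      -γ * inner ℝ (xx (u t) + T L (nl a) - f) (fn (u t)) := by
    rw [hv, vel, inner_sub_right, inner_I_smul_self, real_inner_smul_right]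
    ring
  rw [e1]
  rw [inner_sub_left, inner_add_left, inner_sub_left, inner_add_left, e2, inner_xx,
    real_inner_self_eq_norm_sq] at e3
  simp only [energy, inner_zero_left, add_zero, ← ha]
  linear_combination 2 * e3

/-! ### Invariant sets -/

/-- A functional that decays towards `C` along solutions is at most `C` on compact invariant
sets, since their points have arbitrarily long histories there. -/
lemma le_of_isInvariant {γ : ℝ} (hγ : 0 < γ) {f : L2per L} {K : Set (H2per L)} (hK : IsCompact K)
    (hinv : IsInvariant γ f K) {Φ : H2per L → ℝ} (hΦ : ContinuousOn Φ K) {C : ℝ}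
    (h : ∀ u : ℝ → H2per L, (∀ t, 0 < t → SolvesAt γ f u t) → (∀ t, 0 ≤ t → u t ∈ K) →
      ∀ t, 0 < t → ∃ r, HasDerivAt (fun s => Φ (u s)) (-(2 * γ) * Φ (u t) + r) t ∧ r ≤ 2 * γ * C)
    {w : H2per L} (hw : w ∈ K) : Φ w ≤ C := by
  obtain ⟨B, hB⟩ := hK.exists_bound_of_continuousOn hΦ
  have key (τ : ℝ) (hτ : 0 ≤ τ) : Φ w ≤ C + Real.exp (-(2 * γ) * τ) * (B - C) := by
    have hw' := hw
    rw [← hinv τ hτ] at hw'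
    obtain ⟨u, hu, hu0, rfl⟩ := hw'
    have hmem (t : ℝ) (ht : 0 ≤ t) : u t ∈ K := by
      rw [← hinv t ht]
      exact ⟨u, hu, hu0, rfl⟩
    have hs (t : ℝ) (ht : 0 < t) : SolvesAt γ f u t := hu.solvesAt (Ici_mem_nhds ht)
    have hanti : AntitoneOn (fun t => Real.exp (2 * γ * t) * (Φ (u t) - C)) (Set.Ici 0) := by
      have hd (t : ℝ) (ht : 0 < t) : ∃ d, HasDerivAt
          (fun t => Real.exp (2 * γ * t) * (Φ (u t) - C)) d t ∧ d ≤ 0 := by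
        obtain ⟨r, hr, hr'⟩ := h u hs hmem t ht
        have h1 : HasDerivAt (fun t => Real.exp (2 * γ * t)) (Real.exp (2 * γ * t) * (2 * γ)) t := by
          simpa using ((hasDerivAt_id t).const_mul (2 * γ)).exp
        refine ⟨_, h1.mul (hr.sub_const C), ?_⟩
        have h2 := Real.exp_pos (2 * γ * t)
        nlinarith
      apply antitoneOn_of_deriv_nonpos (convex_Ici 0)
      · refine Continuous.continuousOn (by fun_prop) |>.mul ?_
        exact (hΦ.comp hu.1 hmem).sub continuousOn_const
      · intro t ht
        rw [interior_Ici] at ht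
        obtain ⟨d, hd, -⟩ := hd t ht
        exact hd.differentiableAt.differentiableWithinAt
      · intro t ht
        rw [interior_Ici] at ht
        obtain ⟨d, hd, hd'⟩ := hd t ht
        rwa [hd.deriv]
    have h1 := hanti Set.self_mem_Ici hτ hτ
    simp only [mul_zero, Real.exp_zero, one_mul] at h1
    have h2 := (le_abs_self _).trans (hB _ hu0)
    have h3 : Real.exp (-(2 * γ) * τ) * Real.exp (2 * γ * τ) = 1 := by
      rw [← Real.exp_add]; simp
    have h4 := Real.exp_pos (-(2 * γ) * τ)
    have h5 := mul_le_mul_of_nonneg_left (h1.trans (sub_le_sub_right h2 C)) h4.le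
    rw [← mul_assoc, h3, one_mul] at h5
    linarith
  have hlim : Tendsto (fun τ : ℝ => C + Real.exp (-(2 * γ) * τ) * (B - C)) atTop (𝓝 C) := by
    have h1 : Tendsto (fun τ : ℝ => Real.exp (-(2 * γ) * τ)) atTop (𝓝 0) :=
      Real.tendsto_exp_atBot.comp (tendsto_id.const_mul_atTop_of_neg (by linarith))
    simpa using (h1.mul_const (B - C)).const_add C
  exact ge_of_tendsto hlim ((eventually_ge_atTop 0).mono key)

end

section

/-! ### The bounding expressions -/

lemma R0_nonneg {γ F : ℝ} (hγ : 0 < γ) (hF : 0 ≤ F) : 0 ≤ R0 γ F := div_nonneg hF hγ.le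

lemma R0_mul {γ F : ℝ} (hγ : 0 < γ) : γ * R0 γ F = F := by
  rw [R0]; field_simp

lemma R1_sq {c γ F : ℝ} (hc : 0 < c) (hγ : 0 < γ) (hF : 0 ≤ F) :
    R1 c γ F ^ 2 = 9 / 8 * c ^ 2 * R0 γ F ^ 6 + 3 * c * R0 γ F ^ 4 + 18 * (F * R0 γ F)
      + 4 * R0 γ F ^ 2 := by
  have h0 := R0_nonneg hγ hF
  have h1 : (6 * γ * K2 c γ F + K1 γ F) / γ = 9 / 8 * c ^ 2 * R0 γ F ^ 6 + 3 * c * R0 γ F ^ 4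
      + 18 * (F * R0 γ F) + 4 * R0 γ F ^ 2 := by
    rw [K2, K1]
    field_simp
    ring
  rw [R1, h1, Real.sq_sqrt (by positivity)]

lemma R1_nonneg (c γ F : ℝ) : 0 ≤ R1 c γ F := Real.sqrt_nonneg _

lemma two_R0_le_R1 {c γ F : ℝ} (hc : 0 < c) (hγ : 0 < γ) (hF : 0 ≤ F) :
    2 * R0 γ F ≤ R1 c γ F := by
  have h0 := R0_nonneg hγ hF
  refine le_of_sq_le_sq ?_ (R1_nonneg _ _ _)
  rw [R1_sq hc hγ hF, mul_pow]
  have : 0 ≤ 9 / 8 * c ^ 2 * R0 γ F ^ 6 + 3 * c * R0 γ F ^ 4 + 18 * (F * R0 γ F) := by positivity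
  linarith

/-- The part of `R'` that is not `R2`, without the generic constant. -/
def lowerOrder (c γ F : ℝ) : ℝ := R0 γ F ^ 2 * R1 c γ F + γ * R0 γ F + F

lemma le_R2_sq {c γ F : ℝ} (hc : 0 < c) (hγ : 0 < γ) (hF : 0 ≤ F) :
    8 * c * (R0 γ F ^ 2 * R1 c γ F ^ 8 / γ ^ 4)
      + 8 * c * (R0 γ F * R1 c γ F * lowerOrder c γ F / γ) ^ 2
      + 4 * c * (R0 γ F * R1 c γ F ^ 3) ≤ R2 c γ F ^ 2 := by
  have h0 := R0_nonneg hγ hF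
  have h1 := R1_nonneg c γ F
  have h2 : 4 * K6 c γ F / γ + 4 * K7 c γ F = 8 * c * (R0 γ F ^ 2 * R1 c γ F ^ 8 / γ ^ 4)
      + 8 * c * (R0 γ F * R1 c γ F * lowerOrder c γ F / γ) ^ 2
      + 4 * c * (R0 γ F * R1 c γ F ^ 3) + 8 * (c * F ^ 2) := by
    have h3 : (√(R0 γ F) * R1 c γ F ^ 2) ^ 4 = R0 γ F ^ 2 * R1 c γ F ^ 8 := by
      rw [mul_pow, show (4 : ℕ) = 2 * 2 from rfl, pow_mul √(R0 γ F), Real.sq_sqrt h0]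
      ring
    rw [K6, K5, K7, h3, lowerOrder]
    field_simp
    ring
  have h4 : 0 ≤ 8 * (c * F ^ 2) := by positivity
  have h5 : 0 ≤ 4 * K6 c γ F / γ + 4 * K7 c γ F := by rw [h2]; positivity
  have h6 : √(4 * K6 c γ F / γ + 4 * K7 c γ F) ^ 2 ≤ R2 c γ F ^ 2 :=
    pow_le_pow_left₀ (Real.sqrt_nonneg _) (by rw [R2]; linarith) 2
  rw [Real.sq_sqrt h5, h2] at h6
  linarith

lemma R2_nonneg {c γ F : ℝ} (hγ : 0 < γ) (hF : 0 ≤ F) : 0 ≤ R2 c γ F :=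
  add_nonneg (Real.sqrt_nonneg _) (R0_nonneg hγ hF)

variable {L : ℝ} [hL : Fact (0 < L)]

/-! ### A priori bounds on compact invariant sets -/

lemma T_nl (u : H2per L) : T L (nl (cf L u)) = M L (star (cf L u) * cf L u) (fn u) := by
  rw [← T_cf, M_T, nl]

lemma inner_fn_vel (γ : ℝ) (f : L2per L) (u : H2per L) :
    inner ℝ (fn u) (vel γ f u) = - inner ℝ (fn u) (Complex.I • f) - γ * ‖fn u‖ ^ 2 := by
  have hs : star (star (cf L u) * cf L u) = star (cf L u) * cf L u := by
    simp [mul_comm]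
  rw [vel, inner_sub_right, smul_sub, inner_sub_right, smul_add, inner_add_right, inner_xx_I, T_nl,
    inner_I_real_mul hs, real_inner_smul_right, real_inner_self_eq_norm_sq]
  ring

lemma norm_I_smul (w : L2per L) : ‖Complex.I • w‖ = ‖w‖ := by
  rw [norm_smul, Complex.norm_I, one_mul]

/-- The `L²` bound, evaluated at a point of `K` where the norm is largest. -/
lemma norm_fn_le_R0 {γ : ℝ} (hγ : 0 < γ) {f : L2per L} {K : Set (H2per L)} (hK : IsCompact K)
    (hinv : IsInvariant γ f K) {w : H2per L} (hw : w ∈ K) : ‖fn w‖ ≤ R0 γ ‖f‖ := by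
  have hc : Continuous fun u : H2per L => ‖fn u‖ := continuous_fn.norm
  obtain ⟨w₀, hw₀, hmax⟩ := hK.exists_isMaxOn ⟨w, hw⟩ hc.continuousOn
  refine (hmax hw).trans ?_
  have h := le_of_isInvariant hγ hK hinv (Φ := fun u => ‖fn u‖ ^ 2) (C := R0 γ ‖f‖ * ‖fn w₀‖)
    (hc.pow 2).continuousOn (by
      intro u hu hmem t ht
      refine ⟨-2 * inner ℝ (fn (u t)) (Complex.I • f), ?_, ?_⟩
      · convert! (hu t ht).deriv.norm_sq using 1
        rw [inner_fn_vel]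
        ring
      · have h1 := abs_le.1 (abs_inner_le (hmax (hmem t ht.le)) (norm_I_smul f).le)
        rw [mul_assoc, ← mul_assoc γ, R0_mul hγ]
        have h2 := h1.1
        linarith) hw₀
  rcases (norm_nonneg (fn w₀)).eq_or_lt with h0 | h0
  · change ‖fn w₀‖ ≤ _
    rw [← h0]
    exact R0_nonneg hγ (norm_nonneg _)
  · rw [sq] at h
    exact le_of_mul_le_mul_right h h0

lemma norm_cf_sq_le {L₀ : ℝ} (hL₀ : 0 < L₀) (hLL : L₀ ≤ L) (w : H2per L) :
    ‖cf L w‖ ^ 2 ≤ ‖fn w‖ ^ 2 / L₀ + 2 * ‖fn w‖ * ‖T L (dx L w)‖ := by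
  have h := agmon (cf_dx w)
  rw [T_cf] at h
  refine h.trans ?_
  gcongr

/-- The `H¹` bound. At a point of `K` where `‖u_x‖ = Y` is largest, the energy estimate and Agmon's
inequality give `Y² ≤ R₀⁴ / L₀ + 2 R₀³ Y + 3 F R₀`. -/
lemma norm_dx_le_R1 {L₀ c γ : ℝ} (hL₀ : 0 < L₀) (hLL : L₀ ≤ L) (hc : 1 / L₀ + 2 ≤ c) (hγ : 0 < γ)
    {f : L2per L} {K : Set (H2per L)} (hK : IsCompact K) (hinv : IsInvariant γ f K) {w : H2per L}
    (hw : w ∈ K) : ‖T L (dx L w)‖ ≤ R1 c γ ‖f‖ := by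
  have hcd : Continuous fun u : H2per L => ‖T L (dx L u)‖ := by fun_prop
  obtain ⟨w₀, hw₀, hmax⟩ := hK.exists_isMaxOn ⟨w, hw⟩ hcd.continuousOn
  refine (hmax hw).trans ?_
  have hmax' (z : H2per L) (hz : z ∈ K) : ‖T L (dx L z)‖ ≤ ‖T L (dx L w₀)‖ := hmax hz
  have hF : 0 ≤ ‖f‖ := norm_nonneg f
  have hR := R0_nonneg hγ hF
  set F := ‖f‖ with hFdef
  set R := R0 γ F with hRdef
  set Y := ‖T L (dx L w₀)‖ with hY
  have hY0 : 0 ≤ Y := norm_nonneg _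
  have hfn (z : H2per L) (hz : z ∈ K) : ‖fn z‖ ≤ R := norm_fn_le_R0 hγ hK hinv hz
  have hN (z : H2per L) (hz : z ∈ K) :
      ‖T L (star (cf L z) * cf L z)‖ ^ 2 ≤ R ^ 2 * (R ^ 2 / L₀ + 2 * R * Y) := by
    have h1 : ‖T L (star (cf L z) * cf L z)‖ ≤ ‖cf L z‖ * ‖fn z‖ := by
      rw [← T_cf z, ← norm_star (cf L z)]
      exact norm_T_mul_le _ _
    have h2 := norm_cf_sq_le hL₀ hLL z
    have h3 := hfn z hz
    have h4 := hmax' z hz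
    calc ‖T L (star (cf L z) * cf L z)‖ ^ 2 ≤ (‖cf L z‖ * ‖fn z‖) ^ 2 :=
          pow_le_pow_left₀ (norm_nonneg _) h1 2
      _ = ‖fn z‖ ^ 2 * ‖cf L z‖ ^ 2 := by ring
      _ ≤ ‖fn z‖ ^ 2 * (‖fn z‖ ^ 2 / L₀ + 2 * ‖fn z‖ * ‖T L (dx L z)‖) :=
          mul_le_mul_of_nonneg_left h2 (sq_nonneg _)
      _ ≤ R ^ 2 * (R ^ 2 / L₀ + 2 * R * Y) := by
          have h5 := norm_nonneg (fn z)
          have h6 := norm_nonneg (T L (dx L z))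
          clear_value R Y
          gcongr
  have hin (z : H2per L) (hz : z ∈ K) : |inner ℝ f (fn z)| ≤ F * R :=
    abs_inner_le le_rfl (hfn z hz)
  have h := le_of_isInvariant hγ hK hinv (Φ := energy f)
    (C := 2⁻¹ * (R ^ 2 * (R ^ 2 / L₀ + 2 * R * Y)) + F * R)
    (by
      have := continuous_fn (L := L)
      unfold energy
      fun_prop)
    (fun u hu hmem t ht => ⟨_, (hu t ht).hasDerivAt_energy, by
      have h1 := hN _ (hmem t ht.le)
      have h2 := (abs_le.1 (hin _ (hmem t ht.le))).2
      gcongr⟩) hw₀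
  rw [energy] at h
  have h1 := hN w₀ hw₀
  have h2 := (abs_le.1 (hin w₀ hw₀)).1
  have h3 : Y ^ 2 ≤ R ^ 2 * (R ^ 2 / L₀ + 2 * R * Y) + 3 * (F * R) := by
    rw [← hY] at h
    linarith
  refine le_of_sq_le_sq ?_ (R1_nonneg _ _ _)
  have hL₀' : 0 < 1 / L₀ := by positivity
  have hc0 : 2 ≤ c := by linarith
  rw [R1_sq (by linarith) hγ hF, ← hRdef]
  have h4 : R ^ 2 * (R ^ 2 / L₀) ≤ c * R ^ 4 := by
    rw [show R ^ 2 * (R ^ 2 / L₀) = 1 / L₀ * R ^ 4 by ring]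
    gcongr
    linarith
  have h5 : 0 ≤ F * R := by positivity
  have h6 : 4 * R ^ 6 ≤ c ^ 2 * R ^ 6 := by
    gcongr
    nlinarith
  have h7 : 0 ≤ c * R ^ 4 := by positivity
  have h8 : 0 ≤ R ^ 6 := by positivity
  nlinarith [sq_nonneg (Y - 2 * R ^ 3), sq_nonneg R]

/-- The bound of `‖u‖_∞²`; the term `‖u‖² / L` of Agmon's inequality is absorbed by `2 R₀ ≤ R₁`. -/
lemma norm_cf_sq_le_Rinf {L₀ c γ : ℝ} (hL₀ : 0 < L₀) (hLL : L₀ ≤ L) (hc : 1 / L₀ + 2 ≤ c)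
    (hγ : 0 < γ) {f : L2per L} {K : Set (H2per L)} (hK : IsCompact K) (hinv : IsInvariant γ f K)
    {w : H2per L} (hw : w ∈ K) :
    ‖cf L w‖ ^ 2 ≤ (1 / L₀ + 2) * R0 γ ‖f‖ * R1 c γ ‖f‖ := by
  have h0 := norm_fn_le_R0 hγ hK hinv hw
  have h1 := norm_dx_le_R1 hL₀ hLL hc hγ hK hinv hw
  have hF : 0 ≤ ‖f‖ := norm_nonneg f
  have hR := R0_nonneg hγ hF
  have hL₀' : 0 < 1 / L₀ := by positivity
  have h2 := two_R0_le_R1 (c := c) (by linarith) hγ hF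
  have h3 := R1_nonneg c γ ‖f‖
  refine (norm_cf_sq_le hL₀ hLL w).trans ?_
  calc _ ≤ R0 γ ‖f‖ ^ 2 / L₀ + 2 * R0 γ ‖f‖ * R1 c γ ‖f‖ := by gcongr
    _ = 1 / L₀ * (R0 γ ‖f‖ * R0 γ ‖f‖) + 2 * R0 γ ‖f‖ * R1 c γ ‖f‖ := by ring
    _ ≤ 1 / L₀ * (R0 γ ‖f‖ * R1 c γ ‖f‖) + 2 * R0 γ ‖f‖ * R1 c γ ‖f‖ := by gcongr; linarith
    _ = _ := by ring

/-- Agmon's inequality for `u_x`, which has mean zero, with a constant independent of `L`. -/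
lemma norm_dx_sq_le (w : H2per L) : ‖dx L w‖ ^ 2 ≤ 3 * (‖T L (dx L w)‖ * ‖xx w‖) := by
  have hL0 := hL.out
  have hpi := Real.pi_gt_three
  have h1 := agmon (dx_xx w)
  have h2 := poincare_of_deriv (cf_dx w) (dx_xx w)
  have h3 : ‖T L (dx L w)‖ / L ≤ ‖xx w‖ := by
    refine le_trans ?_ h2
    rw [div_mul_eq_mul_div]
    gcongr
    nlinarith [norm_nonneg (T L (dx L w))]
  have h4 : ‖T L (dx L w)‖ ^ 2 / L = ‖T L (dx L w)‖ * (‖T L (dx L w)‖ / L) := by ring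
  rw [h4] at h1
  have := mul_le_mul_of_nonneg_left h3 (norm_nonneg (T L (dx L w)))
  linarith

end

section

/-! ### The bound of the velocity -/

/-- Absorption of the subquadratic terms in the second order energy estimate. -/
lemma sq_le_of_absorb {X b G p S T : ℝ} (hG : G ^ 2 ≤ p * X)
    (h : X ^ 2 ≤ S + b * G * X + T * X) : X ^ 2 ≤ 2 * S + 16 * (b ^ 2 * p) ^ 2 + 4 * T ^ 2 := by
  have h1 : b * G * X ≤ X ^ 2 / 8 + 2 * (b ^ 2 * (p * X)) := by
    have : b ^ 2 * G ^ 2 ≤ b ^ 2 * (p * X) := by gcongr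
    nlinarith [sq_nonneg (X - 4 * (b * G))]
  have h2 : 2 * (b ^ 2 * p) * X ≤ X ^ 2 / 8 + 8 * (b ^ 2 * p) ^ 2 := by
    nlinarith [sq_nonneg (X - 8 * (b ^ 2 * p))]
  have h3 : T * X ≤ X ^ 2 / 8 + 2 * T ^ 2 := by nlinarith [sq_nonneg (X - 4 * T)]
  nlinarith [sq_nonneg X, sq_nonneg T, sq_nonneg (b ^ 2 * p)]

/-- A number `X` that satisfies the second order estimate, with the constant `c₁` of the embeddings,
is below the bound with a large generic constant `c`. -/
lemma le_of_second_order_estimate {c c₁ γ F R S m A G X r : ℝ} (hc₁ : 1 ≤ c₁) (hc : c₁ ≤ c)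
    (hc2 : 5832 * c₁ ^ 2 ≤ c) (hc4 : c₁ ^ 4 ≤ c) (hγ : 0 < γ) (hF : 0 ≤ F) (hR : 0 ≤ R)
    (hS : 0 ≤ S) (hr : 0 ≤ r)
    (hr2 : 8 * c * (R ^ 2 * S ^ 8 / γ ^ 4)
      + 8 * c * (R * S * (R ^ 2 * S + γ * R + F) / γ) ^ 2 + 4 * c * (R * S ^ 3) ≤ r ^ 2)
    (hm2 : m ^ 2 = c₁ * R * S) (hA : A = F + m ^ 2 * R + γ * R)
    (hG2 : G ^ 2 = 3 * (S * (X + A)))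
    (hX2 : X ^ 2 ≤ 2 * (m ^ 2 * S ^ 2) + 3 * m * S / γ * G * X + m ^ 2 * A / γ * X) :
    X ≤ r + (c * R ^ 2 * S + γ * R + F) := by
  by_contra! hlt
  have hA0 : 0 ≤ A := by rw [hA]; positivity
  have hAle : A ≤ c * R ^ 2 * S + γ * R + F := by
    have h1 : m ^ 2 * R ≤ c * R ^ 2 * S := by
      rw [hm2, show c₁ * R * S * R = c₁ * R ^ 2 * S by ring]
      gcongr
    linarith
  -- Beyond the claimed bound, `A` is dominated by `X` and every term is subquadratic in `X`.
  have hAX : A ≤ X := by linarith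
  have hB0 : 0 ≤ R ^ 2 * S + γ * R + F := by positivity
  have hA1 : A ≤ c₁ * (R ^ 2 * S + γ * R + F) := by
    rw [hA, hm2]
    have h1 : 0 ≤ γ * R + F := by positivity
    nlinarith
  generalize R ^ 2 * S + γ * R + F = B at *
  have hG3 : G ^ 2 ≤ (6 * S) * X := by
    rw [hG2]
    nlinarith [mul_le_mul_of_nonneg_left hAX hS]
  have hfin := sq_le_of_absorb hG3 hX2
  have e1 : ((3 * m * S / γ) ^ 2 * (6 * S)) ^ 2 =
      2916 * c₁ ^ 2 * (R ^ 2 * S ^ 8 / γ ^ 4) := by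
    have : ((3 * m * S / γ) ^ 2 * (6 * S)) ^ 2 = 2916 * (m ^ 2) ^ 2 * S ^ 6 / γ ^ 4 := by ring
    rw [this, hm2]
    ring
  have e2 : (m ^ 2 * A / γ) ^ 2 ≤ c₁ ^ 4 * (R * S * B / γ) ^ 2 := by
    rw [hm2, show c₁ ^ 4 * (R * S * B / γ) ^ 2 = (c₁ * R * S * (c₁ * B) / γ) ^ 2 by ring]
    gcongr
  have e3 : 16 * (2916 * c₁ ^ 2 * (R ^ 2 * S ^ 8 / γ ^ 4)) ≤ 8 * c * (R ^ 2 * S ^ 8 / γ ^ 4) := by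
    rw [← mul_assoc]
    exact mul_le_mul_of_nonneg_right (by linarith) (by positivity)
  have e4 : c₁ ^ 4 * (R * S * B / γ) ^ 2 ≤ c * (R * S * B / γ) ^ 2 := by gcongr
  have e5 : m ^ 2 * S ^ 2 ≤ c * (R * S ^ 3) := by
    rw [hm2, show c₁ * R * S * S ^ 2 = c₁ * (R * S ^ 3) by ring]
    gcongr
  have e6 : 0 ≤ c * (R * S * B / γ) ^ 2 := by
    have : 0 ≤ c := by linarith
    positivity
  have h8 : X ^ 2 ≤ r ^ 2 := by
    rw [e1] at hfin
    linarith
  have h9 : X ≤ r := le_of_sq_le_sq h8 hr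
  linarith

variable {L : ℝ} [hL : Fact (0 < L)]

/-- The bound of `‖u_t‖`, from the functional `‖u_t‖² + Re ∫ ū² u_x²` at a point of `K` where `‖u_t‖`
is largest. -/
lemma norm_vel_le_R' {L₀ c c₁ γ : ℝ} (hL₀ : 0 < L₀) (hLL : L₀ ≤ L) (hc₁ : c₁ = 1 / L₀ + 2)
    (hc : c₁ ≤ c) (hc2 : 5832 * c₁ ^ 2 ≤ c) (hc4 : c₁ ^ 4 ≤ c) (hγ : 0 < γ)
    {f : L2per L} {K : Set (H2per L)} (hK : IsCompact K) (hinv : IsInvariant γ f K) {w : H2per L}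
    (hw : w ∈ K) : ‖vel γ f w‖ ≤ R' c γ ‖f‖ := by
  have hcv : Continuous fun u : H2per L => ‖vel γ f u‖ := (continuous_vel γ f).norm
  obtain ⟨w₀, hw₀, hmax⟩ := hK.exists_isMaxOn ⟨w, hw⟩ hcv.continuousOn
  refine (hmax hw).trans ?_
  change ‖vel γ f w₀‖ ≤ _
  have hmax' (z : H2per L) (hz : z ∈ K) : ‖vel γ f z‖ ≤ ‖vel γ f w₀‖ := hmax hz
  have hL₀' : 0 < 1 / L₀ := by positivity
  have hc₁1 : 1 ≤ c₁ := by linarith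
  have hF : 0 ≤ ‖f‖ := norm_nonneg f
  have hc0 : 0 < c := by linarith
  have hR := R0_nonneg hγ hF
  have hS := R1_nonneg c γ ‖f‖
  have hR2 := R2_nonneg (c := c) hγ hF
  have hR2sq := le_R2_sq hc0 hγ hF
  have hR' : R' c γ ‖f‖ = R2 c γ ‖f‖ + (c * R0 γ ‖f‖ ^ 2 * R1 c γ ‖f‖ + γ * R0 γ ‖f‖ + ‖f‖) := by
    rw [R']; ring
  rw [lowerOrder] at hR2sq
  have hfn (z : H2per L) (hz : z ∈ K) : ‖fn z‖ ≤ R0 γ ‖f‖ := norm_fn_le_R0 hγ hK hinv hz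
  have hdx (z : H2per L) (hz : z ∈ K) : ‖T L (dx L z)‖ ≤ R1 c γ ‖f‖ :=
    norm_dx_le_R1 hL₀ hLL (hc₁ ▸ hc) hγ hK hinv hz
  have hcf (z : H2per L) (hz : z ∈ K) : ‖cf L z‖ ^ 2 ≤ c₁ * R0 γ ‖f‖ * R1 c γ ‖f‖ := by
    rw [hc₁]
    exact norm_cf_sq_le_Rinf hL₀ hLL (hc₁ ▸ hc) hγ hK hinv hz
  set F := ‖f‖ with hFdef
  set R := R0 γ F with hRdef
  set S := R1 c γ F with hSdef
  set X := ‖vel γ f w₀‖ with hXdef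
  have hX : 0 ≤ X := norm_nonneg _
  obtain ⟨m, hm, hm2⟩ : ∃ m, 0 ≤ m ∧ m ^ 2 = c₁ * R * S :=
    ⟨√(c₁ * R * S), Real.sqrt_nonneg _, Real.sq_sqrt (by positivity)⟩
  set A := F + m ^ 2 * R + γ * R with hA
  have hA0 : 0 ≤ A := by positivity
  obtain ⟨G, hG, hG2⟩ : ∃ G, 0 ≤ G ∧ G ^ 2 = 3 * (S * (X + A)) :=
    ⟨√(3 * (S * (X + A))), Real.sqrt_nonneg _, Real.sq_sqrt (by positivity)⟩
  have hcf' (z : H2per L) (hz : z ∈ K) : ‖cf L z‖ ≤ m :=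
    le_of_sq_le_sq (by rw [hm2]; exact hcf z hz) hm
  -- `u_xx + i u_t` is of lower order, by the equation.
  have hlo (z : H2per L) (hz : z ∈ K) : ‖xx z + Complex.I • vel γ f z‖ ≤ A := by
    have e : xx z + Complex.I • vel γ f z =
        f - T L (nl (cf L z)) - Complex.I • (γ • fn z) := by
      rw [vel, smul_sub, smul_smul, Complex.I_mul_I]
      module
    rw [e]
    refine norm_sub_le_of_le (norm_sub_le_of_le le_rfl ?_) ?_
    · rw [T_nl]
      refine (norm_M_le _ _).trans ?_
      have h1 := hcf' z hz
      have h2 := hfn z hz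
      have h3 : ‖star (cf L z) * cf L z‖ ≤ m ^ 2 := by
        refine (norm_mul_le _ _).trans ?_
        rw [norm_star, ← sq]
        gcongr
      exact mul_le_mul h3 h2 (norm_nonneg _) (by positivity)
    · rw [norm_I_smul, norm_smul, Real.norm_eq_abs, abs_of_pos hγ]
      exact mul_le_mul_of_nonneg_left (hfn z hz) hγ.le
  have hdxG (z : H2per L) (hz : z ∈ K) : ‖dx L z‖ ≤ G := by
    refine le_of_sq_le_sq ((norm_dx_sq_le z).trans ?_) hG
    rw [hG2]
    have h1 : ‖xx z‖ ≤ X + A := by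
      have e : xx z = (xx z + Complex.I • vel γ f z) - Complex.I • vel γ f z := by abel
      rw [e, add_comm X]
      exact norm_sub_le_of_le (hlo z hz) (by rw [norm_I_smul]; exact hmax' z hz)
    exact mul_le_mul_of_nonneg_left (mul_le_mul (hdx z hz) h1 (norm_nonneg _) hS) (by norm_num)
  have hcorr (z : H2per L) (hz : z ∈ K) : |corr z| ≤ m ^ 2 * S ^ 2 := by
    have e : corr z = inner ℝ (M L (cf L z * cf L z) (T L (star (dx L z)))) (T L (dx L z)) := by
      rw [corr, M_T, mul_comm _ (star _), ← M_T (star _), inner_M_left, star_star, M_T]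
    rw [e]
    have h1 : ‖M L (cf L z * cf L z) (T L (star (dx L z)))‖ ≤ m ^ 2 * S := by
      refine (norm_M_le _ _).trans ?_
      rw [← cj_T, norm_cj, sq]
      exact mul_le_mul ((norm_mul_le _ _).trans
        (mul_le_mul (hcf' z hz) (hcf' z hz) (norm_nonneg _) hm)) (hdx z hz) (norm_nonneg _)
        (by positivity)
    refine (abs_inner_le h1 (hdx z hz)).trans (le_of_eq (by ring))
  have hcub (z : H2per L) (hz : z ∈ K) (a g h : Cper L) (ha : ‖a‖ ≤ m) (hg : ‖g‖ ≤ G)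
      (hh : ‖T L h‖ ≤ S) : |inner ℝ (vel γ f z) (T L (a * (g * h)))| ≤ X * (m * (G * S)) := by
    refine abs_inner_le (hmax' z hz) ((norm_T_mul_le _ _).trans ?_)
    exact mul_le_mul ha ((norm_T_mul_le _ _).trans (mul_le_mul hg hh (norm_nonneg _) hG))
      (norm_nonneg _) hm
  have key := le_of_isInvariant hγ hK hinv (Φ := fun z => ‖vel γ f z‖ ^ 2 + corr z)
    (C := m ^ 2 * S ^ 2 + (3 * X * (m * (G * S)) + X * (m ^ 2 * A)) / γ)
    (by
      refine ((hcv.pow 2).add ?_).continuousOn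
      unfold corr
      fun_prop)
    (by
      intro u hu hmem t ht
      have hmt := hmem t ht.le
      have d := (hasDerivAt_norm_vel_sq ((eventually_gt_nhds ht).mono hu)).add
        (hu t ht).hasDerivAt_corr
      set z := u t with hz
      set v := vel γ f z with hv
      refine ⟨2 * γ * corr z + 2 * inner ℝ v (T L (star (cf L z) * (dx L z * dx L z)))
        - 4 * inner ℝ v (T L (cf L z * (dx L z * star (dx L z))))
        - 2 * inner ℝ v (M L (cf L z * cf L z) (cj L (xx z + Complex.I • v))), ?_, ?_⟩
      · convert! d using 1
        have e : inner ℝ v (M L (cf L z * cf L z) (cj L (xx z + Complex.I • v))) =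
            inner ℝ v (M L (cf L z * cf L z) (cj L (xx z))) -
              inner ℝ v (Complex.I • M L (cf L z * cf L z) (cj L v)) := by
          rw [map_add, map_add, inner_add_right, cj_smul, map_smul, Complex.star_def,
            Complex.conj_I, neg_smul, inner_neg_right]
          ring
        rw [e]
        ring
      · have h1 := (abs_le.1 (hcorr z hmt)).2
        have h2 := (abs_le.1 (hcub z hmt (star (cf L z)) (dx L z) (dx L z)
          (by rw [norm_star]; exact hcf' z hmt) (hdxG z hmt) (hdx z hmt))).2
        have h3 := (abs_le.1 (hcub z hmt (cf L z) (dx L z) (star (dx L z))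
          (hcf' z hmt) (hdxG z hmt) (by rw [← cj_T, norm_cj]; exact hdx z hmt))).1
        have h4 : |inner ℝ v (M L (cf L z * cf L z) (cj L (xx z + Complex.I • v)))| ≤
            X * (m ^ 2 * A) := by
          refine abs_inner_le (hmax' z hmt) ((norm_M_le _ _).trans ?_)
          rw [norm_cj, sq]
          exact mul_le_mul ((norm_mul_le _ _).trans
            (mul_le_mul (hcf' z hmt) (hcf' z hmt) (norm_nonneg _) hm)) (hlo z hmt) (norm_nonneg _)
            (by positivity)
        have h5 := (abs_le.1 h4).1
        have e : 2 * γ * (m ^ 2 * S ^ 2 + (3 * X * (m * (G * S)) + X * (m ^ 2 * A)) / γ) =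
            2 * γ * (m ^ 2 * S ^ 2) + 6 * (X * (m * (G * S))) + 2 * (X * (m ^ 2 * A)) := by
          field_simp
          ring
        rw [e]
        have h6 := mul_le_mul_of_nonneg_left h1 hγ.le
        linarith) hw₀
  have hX2 : X ^ 2 ≤ 2 * (m ^ 2 * S ^ 2) + 3 * m * S / γ * G * X + m ^ 2 * A / γ * X := by
    have h1 := (abs_le.1 (hcorr w₀ hw₀)).1
    have e : (3 * X * (m * (G * S)) + X * (m ^ 2 * A)) / γ =
      3 * m * S / γ * G * X + m ^ 2 * A / γ * X := by ring
    simp only [← hXdef] at key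
    linarith
  rw [hR']
  exact le_of_second_order_estimate hc₁1 hc hc2 hc4 hγ hF hR hS hR2 hR2sq hm2 rfl hG2 hX2

end

section

/-! ### Determining modes -/

variable {L : ℝ} [hL : Fact (0 < L)]

lemma Rinf_nonneg {c γ F : ℝ} (hc : 0 < c) (hγ : 0 < γ) (hF : 0 ≤ F) : 0 ≤ Rinf c γ F :=
  mul_nonneg (mul_nonneg hc.le (R0_nonneg hγ hF)) (R1_nonneg _ _ _)

lemma R'_nonneg {c γ F : ℝ} (hc : 0 < c) (hγ : 0 < γ) (hF : 0 ≤ F) : 0 ≤ R' c γ F := by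
  have h0 := R0_nonneg hγ hF
  have h1 := R1_nonneg c γ F
  have h2 := R2_nonneg (c := c) hγ hF
  rw [R']
  positivity

/-- The two consequences of a lower bound by `K11` used in the comparison argument. -/
lemma K11_le_imp {c γ F κ : ℝ} (hc : 0 < c) (hγ : 0 < γ) (hF : 0 ≤ F) (h : K11 c γ F ≤ κ) :
    c * Rinf c γ F ≤ κ ^ 2 ∧
      c ^ 3 * (Rinf c γ F * R' c γ F ^ 2) ^ 2 ≤ (γ ^ 2 * κ ^ 3) ^ 2 := by
  have h0 := Rinf_nonneg hc hγ hF
  have h1 := R'_nonneg hc hγ hF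
  set A := Rinf c γ F
  set V := R' c γ F
  set Q := γ ^ (-(1 / 3) : ℝ) * A ^ (2 / 3 : ℝ) * V ^ (4 / 3 : ℝ) with hQ
  have hQ0 : 0 ≤ Q := by positivity
  have hQ3 : Q ^ 3 = γ⁻¹ * A ^ 2 * V ^ 4 := by
    rw [hQ, mul_pow, mul_pow, ← Real.rpow_natCast, ← Real.rpow_natCast, ← Real.rpow_natCast,
      ← Real.rpow_mul hγ.le, ← Real.rpow_mul h0, ← Real.rpow_mul h1, ← Real.rpow_neg_one,
      ← Real.rpow_natCast, ← Real.rpow_natCast]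
    norm_num
  have hK : K11 c γ F = √((c * γ * A + c * Q) / γ) := by
    change √((c * γ * A + c * γ ^ (-(1 / 3) : ℝ) * A ^ (2 / 3 : ℝ) * V ^ (4 / 3 : ℝ)) / γ) = _
    simp only [hQ, mul_assoc]
  have hsq : (c * γ * A + c * Q) / γ ≤ κ ^ 2 := by
    rw [← Real.sq_sqrt (show 0 ≤ (c * γ * A + c * Q) / γ by positivity), ← hK]
    exact pow_le_pow_left₀ (Real.sqrt_nonneg _) h 2
  have e : (c * γ * A + c * Q) / γ = c * A + c * Q / γ := by field_simp
  rw [e] at hsq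
  have hA0 : 0 ≤ c * A := by positivity
  have hQ1 : 0 ≤ c * Q / γ := by positivity
  refine ⟨by linarith, ?_⟩
  have h3 : (c * Q / γ) ^ 3 ≤ (κ ^ 2) ^ 3 := pow_le_pow_left₀ hQ1 (by linarith) 3
  calc c ^ 3 * (A * V ^ 2) ^ 2 = γ ^ 4 * (c * Q / γ) ^ 3 := by
        rw [div_pow, mul_pow c Q, hQ3]
        field_simp
    _ ≤ γ ^ 4 * (κ ^ 2) ^ 3 := by gcongr
    _ = _ := by ring

/-- The quadratic part of the energy of a difference is a perturbation of `‖δ_x‖²`. -/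
lemma abs_diffEnergy_sub_le {u w : H2per L} {m : ℝ} (hu : ‖cf L u‖ ≤ m) (hw : ‖cf L w‖ ≤ m) :
    |diffEnergy u w - ‖T L (dx L (u - w))‖ ^ 2| ≤ 3 * m ^ 2 * ‖fn (u - w)‖ ^ 2 := by
  have hm : 0 ≤ m := (norm_nonneg _).trans hu
  set δ := u - w
  have e3 : inner ℝ (T L (pp (cf L u) (cf L w))) (T L (star (cf L δ) * cf L δ)) =
      inner ℝ (M L (pp (cf L u) (cf L w)) (fn δ)) (fn δ) := by
    rw [← M_T, ← inner_M_left, M_T, mul_comm, ← M_T, T_cf]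
  have e4 : inner ℝ (T L (qq (cf L u) (cf L w))) (T L (cf L δ * cf L δ)) =
      inner ℝ (M L (qq (cf L u) (cf L w)) (cj L (fn δ))) (fn δ) := by
    rw [← T_cf, cj_T, M_T, mul_comm (qq _ _), ← M_T (star _), inner_M_left, star_star, M_T]
  have hp : ‖pp (cf L u) (cf L w)‖ ≤ 4 * m ^ 2 := by
    refine (norm_mul_le _ _).trans ?_
    have h1 : ‖cf L u + cf L w‖ ≤ 2 * m := (norm_add_le _ _).trans (by linarith)
    rw [norm_star, ← sq, show 4 * m ^ 2 = (2 * m) ^ 2 by ring]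
    gcongr
  have hq : ‖qq (cf L u) (cf L w)‖ ≤ 2 * m ^ 2 := by
    refine (norm_add_le_of_le (norm_mul_le _ _) (norm_mul_le _ _)).trans ?_
    have h1 := mul_le_mul hu hu (norm_nonneg _) hm
    have h2 := mul_le_mul hw hw (norm_nonneg _) hm
    linarith
  have hn := norm_nonneg (fn δ)
  have i3 : |inner ℝ (M L (pp (cf L u) (cf L w)) (fn δ)) (fn δ)| ≤
      4 * m ^ 2 * ‖fn δ‖ * ‖fn δ‖ :=
    abs_inner_le ((norm_M_le _ _).trans (by gcongr)) le_rfl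
  have i4 : |inner ℝ (M L (qq (cf L u) (cf L w)) (cj L (fn δ))) (fn δ)| ≤
      2 * m ^ 2 * ‖fn δ‖ * ‖fn δ‖ :=
    abs_inner_le ((norm_M_le _ _).trans (by rw [norm_cj]; gcongr)) le_rfl
  rw [diffEnergy, e3, e4]
  rw [abs_le] at *
  constructor <;> linarith [i3.1, i3.2, i4.1, i4.2]

/-- A function on the line that is bounded above and decays exponentially forwards in time is
nowhere positive. -/
lemma nonpos_of_decay {φ : ℝ → ℝ} {γ B : ℝ} (hγ : 0 < γ) (hB : ∀ t, φ t ≤ B)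
    (h : ∀ t, ∃ d, HasDerivAt φ d t ∧ d ≤ -γ * φ t) (t : ℝ) : φ t ≤ 0 := by
  have hanti : Antitone fun t => Real.exp (γ * t) * φ t := by
    have hd (t : ℝ) : ∃ d, HasDerivAt (fun t => Real.exp (γ * t) * φ t) d t ∧ d ≤ 0 := by
      obtain ⟨d, hd, hd'⟩ := h t
      have h1 : HasDerivAt (fun t => Real.exp (γ * t)) (Real.exp (γ * t) * γ) t := by
        simpa using ((hasDerivAt_id t).const_mul γ).exp
      refine ⟨_, h1.mul hd, ?_⟩
      have h2 := Real.exp_pos (γ * t)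
      nlinarith
    apply antitone_of_deriv_nonpos
    · intro t
      obtain ⟨d, hd, -⟩ := hd t
      exact hd.differentiableAt
    · intro t
      obtain ⟨d, hd, hd'⟩ := hd t
      rwa [hd.deriv]
  have key : ∀ s, s ≤ t → Real.exp (γ * t) * φ t ≤ Real.exp (γ * s) * B := fun s hs =>
    (hanti hs).trans (mul_le_mul_of_nonneg_left (hB s) (Real.exp_pos _).le)
  have hlim : Tendsto (fun s : ℝ => Real.exp (γ * s) * B) atBot (𝓝 0) := by
    have h1 : Tendsto (fun s : ℝ => Real.exp (γ * s)) atBot (𝓝 0) :=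
      Real.tendsto_exp_atBot.comp (tendsto_id.const_mul_atBot hγ)
    simpa using h1.mul_const B
  have h2 := ge_of_tendsto hlim ((eventually_le_atBot t).mono key)
  exact nonpos_of_mul_nonpos_right h2 (Real.exp_pos _)

/-- The remainder in the energy identity of a difference is dominated by the damping. -/
lemma remainder_le {A V κ γ D n N c m : ℝ} (hγ : 0 < γ) (hD : 0 ≤ D) (hn : 0 ≤ n)
    (hκ : 0 < κ) (hc : 60 ≤ c) (hmA : m ^ 2 ≤ A)
    (hκA : c ^ 3 * (A * V ^ 2) ^ 2 ≤ (γ ^ 2 * κ ^ 3) ^ 2) (hnD : κ * n ≤ D)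
    (hN2 : N ^ 2 ≤ 3 * (n * D)) : 6 * m * V * (N * n) ≤ γ * (D ^ 2 / 2) := by
  have hA : 0 ≤ A := (sq_nonneg m).trans hmA
  -- `432² ≤ 60³ ≤ c³`
  have h1 : 432 * (A * V ^ 2) ≤ γ ^ 2 * κ ^ 3 := by
    refine le_of_sq_le_sq (le_trans ?_ hκA) (by positivity)
    rw [mul_pow]
    refine mul_le_mul_of_nonneg_right ?_ (sq_nonneg _)
    calc (432 : ℝ) ^ 2 ≤ 60 ^ 3 := by norm_num
      _ ≤ c ^ 3 := by gcongr
  refine le_of_sq_le_sq ?_ (by positivity)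
  have h2 : (6 * m * V * (N * n)) ^ 2 ≤ 108 * (A * V ^ 2) * (n ^ 3 * D) := by
    calc (6 * m * V * (N * n)) ^ 2 = 36 * m ^ 2 * V ^ 2 * n ^ 2 * N ^ 2 := by ring
      _ ≤ 36 * A * V ^ 2 * n ^ 2 * (3 * (n * D)) := by gcongr
      _ = _ := by ring
  have h3 : (κ * n) ^ 3 ≤ D ^ 3 := pow_le_pow_left₀ (by positivity) hnD 3
  calc _ ≤ 108 * (A * V ^ 2) * (n ^ 3 * D) := h2
    _ = 432 * (A * V ^ 2) * (n ^ 3 * D / 4) := by ring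
    _ ≤ γ ^ 2 * κ ^ 3 * (n ^ 3 * D / 4) := by gcongr
    _ = γ ^ 2 * D / 4 * (κ * n) ^ 3 := by ring
    _ ≤ γ ^ 2 * D / 4 * D ^ 3 := by gcongr
    _ = _ := by ring

/-- If the wave number `2π (m + 1) / L` exceeds `K11`, the energy of the difference of two trajectories
with equal `P_m` projections is equivalent to `‖δ_x‖²` and decays exponentially, so that it vanishes
as it is bounded for all negative times. -/
theorem isDetermining_of_K11_le {L₀ c c₁ γ : ℝ} (hL₀ : 0 < L₀) (hLL : L₀ ≤ L)
    (hc₁ : c₁ = 1 / L₀ + 2) (hc : c₁ ≤ c) (hc2 : 5832 * c₁ ^ 2 ≤ c) (hc4 : c₁ ^ 4 ≤ c)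
    (hc60 : 60 ≤ c) (hγ : 0 < γ) {f : L2per L} {m : ℕ}
    (hm : L / (2 * Real.pi) * K11 c γ ‖f‖ - 1 ≤ (m : ℝ)) : IsDetermining γ f m := by
  intro u w hu hw hP
  have hL0 := hL.out
  have hpi := Real.pi_pos
  have hF : 0 ≤ ‖f‖ := norm_nonneg f
  have hc0 : 0 < c := by linarith
  have hA0 := Rinf_nonneg hc0 hγ hF
  have hV0 := R'_nonneg hc0 hγ hF
  obtain ⟨κ, hκdef⟩ : ∃ κ : ℝ, κ = 2 * Real.pi / L * (m + 1) := ⟨_, rfl⟩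
  have hκ0 : 0 < κ := by rw [hκdef]; positivity
  have hκ : K11 c γ ‖f‖ ≤ κ := by
    have h1 : K11 c γ ‖f‖ = 2 * Real.pi / L * (L / (2 * Real.pi) * K11 c γ ‖f‖) := by
      field_simp
    rw [hκdef, h1]
    gcongr
    linarith
  obtain ⟨hk1, hk2⟩ := K11_le_imp hc0 hγ hF hκ
  obtain ⟨μ, hμ, hμ2⟩ : ∃ μ, 0 ≤ μ ∧ μ ^ 2 = Rinf c γ ‖f‖ :=
    ⟨√(Rinf c γ ‖f‖), Real.sqrt_nonneg _, Real.sq_sqrt hA0⟩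
  have hR1 := R1_nonneg c γ ‖f‖
  have hR0 := R0_nonneg hγ hF
  have hb {z : H2per L} (hz : z ∈ globalAttractor γ f) :
      ‖T L (dx L z)‖ ≤ R1 c γ ‖f‖ ∧ ‖cf L z‖ ≤ μ ∧ ‖vel γ f z‖ ≤ R' c γ ‖f‖ := by
    obtain ⟨K, ⟨hK, hinv⟩, hzK⟩ := hz
    refine ⟨norm_dx_le_R1 hL₀ hLL (hc₁ ▸ hc) hγ hK hinv hzK, le_of_sq_le_sq ?_ hμ,
      norm_vel_le_R' hL₀ hLL hc₁ hc hc2 hc4 hγ hK hinv hzK⟩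
    rw [hμ2, Rinf]
    refine (norm_cf_sq_le_Rinf hL₀ hLL (hc₁ ▸ hc) hγ hK hinv hzK).trans ?_
    rw [← hc₁]
    gcongr
  have hsu (t : ℝ) : SolvesAt γ f u t := hu.1.solvesAt univ_mem
  have hsw (t : ℝ) : SolvesAt γ f w t := hw.1.solvesAt univ_mem
  have hpoinc (t : ℝ) : κ * ‖fn (u t - w t)‖ ≤ ‖T L (dx L (u t - w t))‖ := by
    have h := poincare (cf_dx (u t - w t)) m (by
      intro k hk
      have h1 : P L m (fn (u t - w t)) = 0 := by rw [fn_sub, map_sub, hP, sub_self]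
      have h2 := (Submodule.starProjection_apply_eq_zero_iff _).1 h1
      rw [T_cf]
      exact h2 _ (Submodule.subset_span ⟨k, hk, rfl⟩))
    rwa [T_cf, ← hκdef] at h
  have hagmon (t : ℝ) : ‖cf L (u t - w t)‖ ^ 2 ≤
      3 * (‖fn (u t - w t)‖ * ‖T L (dx L (u t - w t))‖) := by
    have h1 := agmon (cf_dx (u t - w t))
    rw [T_cf] at h1
    have h3 : ‖fn (u t - w t)‖ / L ≤ ‖T L (dx L (u t - w t))‖ := by
      refine le_trans ?_ (hpoinc t)
      rw [hκdef, div_eq_inv_mul]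
      gcongr
      rw [div_mul_eq_mul_div, inv_eq_one_div]
      gcongr
      nlinarith [Real.pi_gt_three, (Nat.cast_nonneg m : (0 : ℝ) ≤ m)]
    have h4 : ‖fn (u t - w t)‖ ^ 2 / L = ‖fn (u t - w t)‖ * (‖fn (u t - w t)‖ / L) := by ring
    rw [h4] at h1
    have := mul_le_mul_of_nonneg_left h3 (norm_nonneg (fn (u t - w t)))
    linarith
  have hpert (t : ℝ) : |diffEnergy (u t) (w t) - ‖T L (dx L (u t - w t))‖ ^ 2| ≤
      ‖T L (dx L (u t - w t))‖ ^ 2 / 2 := by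
    refine (abs_diffEnergy_sub_le (hb (hu.2 t)).2.1 (hb (hw.2 t)).2.1).trans ?_
    have h1 : (κ * ‖fn (u t - w t)‖) ^ 2 ≤ ‖T L (dx L (u t - w t))‖ ^ 2 :=
      pow_le_pow_left₀ (by positivity) (hpoinc t) 2
    have h2 : 60 * Rinf c γ ‖f‖ * ‖fn (u t - w t)‖ ^ 2 ≤ κ ^ 2 * ‖fn (u t - w t)‖ ^ 2 := by
      refine mul_le_mul_of_nonneg_right (le_trans ?_ hk1) (sq_nonneg _)
      gcongr
    have h3 : 0 ≤ Rinf c γ ‖f‖ * ‖fn (u t - w t)‖ ^ 2 := by positivity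
    rw [hμ2]
    rw [mul_pow] at h1
    linarith
  have hdecay := nonpos_of_decay (φ := fun t => diffEnergy (u t) (w t))
    (B := 3 / 2 * (2 * R1 c γ ‖f‖) ^ 2) hγ
    (by
      intro t
      have h1 := (abs_le.1 (hpert t)).2
      have h2 : ‖T L (dx L (u t - w t))‖ ≤ 2 * R1 c γ ‖f‖ := by
        rw [map_sub, map_sub, two_mul]
        exact norm_sub_le_of_le (hb (hu.2 t)).1 (hb (hw.2 t)).1
      have h3 := pow_le_pow_left₀ (norm_nonneg _) h2 2
      linarith)
    (by
      intro t
      obtain ⟨r, hr, hr'⟩ := (hsu t).hasDerivAt_diffEnergy (hsw t) (hb (hu.2 t)).2.1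
        (hb (hw.2 t)).2.1 (hb (hu.2 t)).2.2 (hb (hw.2 t)).2.2
      refine ⟨_, hr, ?_⟩
      have h1 := remainder_le hγ (norm_nonneg (T L (dx L (u t - w t))))
        (norm_nonneg (fn (u t - w t))) hκ0 hc60
        hμ2.le hk2 (hpoinc t) (hagmon t)
      have h2 := (abs_le.1 (hpert t)).1
      have h3 := (abs_le.1 hr').2
      have h4 : γ * (‖T L (dx L (u t - w t))‖ ^ 2 / 2) ≤ γ * diffEnergy (u t) (w t) := by
        gcongr
        linarith
      linarith)
  intro t
  apply eq_of_fn_eq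
  have h1 := (abs_le.1 (hpert t)).1
  have h2 := hdecay t
  have h3 : ‖T L (dx L (u t - w t))‖ = 0 := by
    have := sq_nonneg ‖T L (dx L (u t - w t))‖
    exact pow_eq_zero_iff two_ne_zero |>.1 (by linarith)
  have h4 := hpoinc t
  rw [h3] at h4
  have h5 : ‖fn (u t - w t)‖ = 0 :=
    le_antisymm (nonpos_of_mul_nonpos_right h4 hκ0) (norm_nonneg _)
  rwa [norm_eq_zero, fn_sub, sub_eq_zero] at h5

end

section

/-! ### Growth of the number of modes -/

/-- Eventually along `l`, `g` is nonnegative and at most a multiple of `Λ ^ n`, where `1 ≤ Λ`. -/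
def PowBdd (l : Filter ℝ) (Λ g : ℝ → ℝ) (n : ℝ) : Prop :=
  ∃ C : ℝ, 0 ≤ C ∧ ∀ᶠ x in l, 1 ≤ Λ x ∧ 0 ≤ g x ∧ g x ≤ C * Λ x ^ n

namespace PowBdd

variable {l : Filter ℝ} {Λ g h : ℝ → ℝ} {n k N : ℝ}

lemma mono (hg : PowBdd l Λ g n) (hn : n ≤ N) : PowBdd l Λ g N := by
  obtain ⟨C, hC, hg⟩ := hg
  refine ⟨C, hC, hg.mono fun x ⟨h1, h2, h3⟩ => ⟨h1, h2, h3.trans ?_⟩⟩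
  gcongr

lemma add (hg : PowBdd l Λ g n) (hh : PowBdd l Λ h n) : PowBdd l Λ (fun x => g x + h x) n := by
  obtain ⟨C, hC, hg⟩ := hg
  obtain ⟨D, hD, hh⟩ := hh
  refine ⟨C + D, add_nonneg hC hD, ?_⟩
  filter_upwards [hg, hh] with x ⟨h1, h2, h3⟩ ⟨_, h5, h6⟩
  exact ⟨h1, add_nonneg h2 h5, by linarith⟩

lemma mul (hg : PowBdd l Λ g n) (hh : PowBdd l Λ h k) :
    PowBdd l Λ (fun x => g x * h x) (n + k) := by
  obtain ⟨C, hC, hg⟩ := hg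
  obtain ⟨D, hD, hh⟩ := hh
  refine ⟨C * D, mul_nonneg hC hD, ?_⟩
  filter_upwards [hg, hh] with x ⟨h1, h2, h3⟩ ⟨_, h5, h6⟩
  refine ⟨h1, mul_nonneg h2 h5, ?_⟩
  have h0 : 0 < Λ x := by linarith
  rw [Real.rpow_add h0]
  calc g x * h x ≤ (C * Λ x ^ n) * (D * Λ x ^ k) := by gcongr
    _ = _ := by ring

lemma const_mul (hg : PowBdd l Λ g n) {c : ℝ} (hc : 0 ≤ c) :
    PowBdd l Λ (fun x => c * g x) n := by
  obtain ⟨C, hC, hg⟩ := hg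
  refine ⟨c * C, mul_nonneg hc hC, ?_⟩
  filter_upwards [hg] with x ⟨h1, h2, h3⟩
  exact ⟨h1, mul_nonneg hc h2, by rw [mul_assoc]; gcongr⟩

lemma rpow (hg : PowBdd l Λ g n) {r : ℝ} (hr : 0 ≤ r) :
    PowBdd l Λ (fun x => g x ^ r) (n * r) := by
  obtain ⟨C, hC, hg⟩ := hg
  refine ⟨C ^ r, by positivity, ?_⟩
  filter_upwards [hg] with x ⟨h1, h2, h3⟩
  have h0 : 0 ≤ Λ x := by linarith
  refine ⟨h1, by positivity, ?_⟩
  rw [Real.rpow_mul h0, ← Real.mul_rpow hC (by positivity)]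
  gcongr

lemma pow (hg : PowBdd l Λ g n) (j : ℕ) : PowBdd l Λ (fun x => g x ^ j) (n * j) := by
  simpa only [Real.rpow_natCast] using hg.rpow (r := j) (by positivity)

lemma sqrt (hg : PowBdd l Λ g n) : PowBdd l Λ (fun x => √(g x)) (n / 2) := by
  simpa only [Real.sqrt_eq_rpow, mul_one_div] using hg.rpow (r := 1 / 2) (by norm_num)

/-- The growth of `K11` in powers of `Λ`, when `F` grows at most like `Λ ^ a` and `γ` has the exact
order `Λ ^ b`. -/
lemma K11 {γ F : ℝ → ℝ} {c a b : ℝ} (hc : 0 < c) (ha : 0 ≤ a) (hb : b ≤ 0)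
    (hF : PowBdd l Λ F a) (hγ : PowBdd l Λ γ b) (hi : PowBdd l Λ (fun x => (γ x)⁻¹) (-b)) :
    PowBdd l Λ (fun x => K11 c (γ x) (F x)) (10 * a - 12 * b) := by
  have h0 : PowBdd l Λ (fun x => R0 (γ x) (F x)) (a - b) := by
    simp only [R0, div_eq_mul_inv]
    exact (hF.mul hi).mono (by linarith)
  have hK1 : PowBdd l Λ (fun x => K1 (γ x) (F x)) (2 * a) := by
    simp only [K1, mul_assoc]
    exact ((hγ.mul (hF.mul h0)).const_mul (by norm_num)).mono (by linarith)
  have hK2 : PowBdd l Λ (fun x => K2 c (γ x) (F x)) (6 * a - 6 * b) := by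
    simp only [K2, mul_assoc, mul_div_right_comm]
    refine PowBdd.add (PowBdd.add (PowBdd.add (n := 6 * a - 6 * b) ?_ ?_) ?_) ?_
    · exact (((h0.pow 6).const_mul (sq_nonneg c)).const_mul (by norm_num)).mono
        (by norm_num; linarith)
    · exact (((h0.pow 4).const_mul hc.le).const_mul (by norm_num)).mono (by norm_num; linarith)
    · exact ((hF.mul h0).const_mul (by norm_num)).mono (by linarith)
    · exact ((h0.pow 2).const_mul (by norm_num)).mono (by norm_num; linarith)
  have h1 : PowBdd l Λ (fun x => R1 c (γ x) (F x)) (3 * a - 3 * b) := by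
    simp only [R1, div_eq_mul_inv, mul_assoc]
    refine PowBdd.mono (PowBdd.sqrt (n := 6 * a - 6 * b) ?_) (by linarith)
    refine (PowBdd.mul (n := 6 * a - 5 * b) (PowBdd.add ?_ ?_) hi).mono (by linarith)
    · exact ((hγ.mul hK2).const_mul (by norm_num)).mono (by linarith)
    · exact hK1.mono (by linarith)
  have h01 : PowBdd l Λ (fun x => R0 (γ x) (F x) ^ 2 * R1 c (γ x) (F x)) (5 * a - 5 * b) :=
    ((h0.pow 2).mul h1).mono (by norm_num; linarith)
  have hγ0 : PowBdd l Λ (fun x => γ x * R0 (γ x) (F x)) a := (hγ.mul h0).mono (by linarith)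
  have hK5 : PowBdd l Λ (fun x => K5 c (γ x) (F x)) (26 * a - 29 * b) := by
    simp only [K5, div_eq_mul_inv, mul_assoc, ← inv_pow]
    refine PowBdd.add ?_ ?_
    · exact ((((h0.sqrt.mul (h1.pow 2)).pow 4).mul (hi.pow 3)).const_mul hc.le).mono
        (by norm_num; linarith)
    · refine (((((h0.mul (h1.mul (PowBdd.add (PowBdd.add (n := 5 * a - 5 * b) h01 ?_) ?_))).pow
        2).mul hi).const_mul hc.le).mono ?_)
      · exact hγ0.mono (by linarith)
      · exact hF.mono (by linarith)
      · norm_num; linarith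
  have hK6 : PowBdd l Λ (fun x => K6 c (γ x) (F x)) (26 * a - 29 * b) := by
    simp only [K6, mul_assoc]
    exact (hK5.const_mul (by norm_num)).add
      (((hγ.mul (hF.pow 2)).const_mul hc.le).mono (by norm_num; linarith))
  have hK7 : PowBdd l Λ (fun x => K7 c (γ x) (F x)) (10 * a - 10 * b) := by
    simp only [K7]
    refine (PowBdd.add ?_ ?_).const_mul hc.le
    · exact (h0.mul (h1.pow 3)).mono (by norm_num; linarith)
    · exact (hF.pow 2).mono (by norm_num; linarith)
  have h2 : PowBdd l Λ (fun x => R2 c (γ x) (F x)) (13 * a - 15 * b) := by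
    simp only [R2, div_eq_mul_inv, mul_assoc]
    refine PowBdd.add (PowBdd.mono (PowBdd.sqrt (n := 26 * a - 30 * b) (PowBdd.add ?_ ?_))
      (by linarith)) (h0.mono (by linarith))
    · exact ((hK6.mul hi).const_mul (by norm_num)).mono (by linarith)
    · exact (hK7.const_mul (by norm_num)).mono (by linarith)
  have h' : PowBdd l Λ (fun x => R' c (γ x) (F x)) (13 * a - 15 * b) := by
    simp only [R', mul_assoc]
    exact ((h2.add ((h01.const_mul hc.le).mono (by linarith))).add (hγ0.mono (by linarith))).add
      (hF.mono (by linarith))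
  have hinf : PowBdd l Λ (fun x => Rinf c (γ x) (F x)) (4 * a - 4 * b) := by
    simp only [Rinf, mul_assoc]
    exact ((h0.mul h1).const_mul hc.le).mono (by linarith)
  have hg : PowBdd l Λ (fun x => γ x ^ (-(1 / 3) : ℝ)) (-b / 3) := by
    obtain ⟨C, hC, hCx⟩ := hi.rpow (r := 1 / 3) (by norm_num)
    obtain ⟨D, -, hDx⟩ := hγ
    refine ⟨C, hC, ?_⟩
    filter_upwards [hCx, hDx] with x hx hx'
    rw [Real.rpow_neg hx'.2.1, ← Real.inv_rpow hx'.2.1, div_eq_mul_one_div (-b)]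
    exact hx
  simp only [NLS.K11, div_eq_mul_inv _ (γ _), mul_assoc]
  refine PowBdd.mono (PowBdd.sqrt (n := 20 * a - 24 * b) ?_) (by linarith)
  refine (PowBdd.mul (n := 20 * a - 23 * b) (PowBdd.add ?_ ?_) hi).mono (by linarith)
  · exact ((hγ.mul hinf).const_mul hc.le).mono (by linarith)
  · exact ((hg.mul ((hinf.rpow (by norm_num)).mul (h'.rpow (by norm_num)))).const_mul
      hc.le).mono (by linarith)

end PowBdd

lemma modeCount_le {c L γ F : ℝ} (hL : 0 < L) :
    (modeCount c L γ F : ℝ) ≤ L / (2 * Real.pi) * K11 c γ F := by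
  have h0 : 0 ≤ L / (2 * Real.pi) * K11 c γ F := by
    have : 0 ≤ K11 c γ F := Real.sqrt_nonneg _
    have := Real.pi_pos
    positivity
  rw [modeCount]
  rcases le_total 0 (L / (2 * Real.pi) * K11 c γ F - 1) with h | h
  · have := Nat.ceil_lt_add_one h
    linarith
  · rw [Nat.ceil_eq_zero.2 h]
    simpa using h0

lemma isBigO_modeCount {l : Filter ℝ} {Λ γ F : ℝ → ℝ} {c L : ℝ} {n : ℕ} (hL : 0 < L)
    (h : PowBdd l Λ (fun x => K11 c (γ x) (F x)) n) :
    (fun x => (modeCount c L (γ x) (F x) : ℝ)) =O[l] fun x => Λ x ^ n := by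
  obtain ⟨C, hC, h⟩ := h
  refine IsBigO.of_bound (L / (2 * Real.pi) * C) ?_
  filter_upwards [h] with x ⟨h1, h2, h3⟩
  rw [Real.rpow_natCast] at h3
  have hpi := Real.pi_pos
  rw [Real.norm_of_nonneg (Nat.cast_nonneg _), Real.norm_of_nonneg (by positivity), mul_assoc]
  exact (modeCount_le hL).trans (by gcongr)

lemma powBdd_self {l : Filter ℝ} {Λ : ℝ → ℝ} (h : ∀ᶠ x in l, 1 ≤ Λ x) : PowBdd l Λ Λ 1 :=
  ⟨1, zero_le_one, h.mono fun x hx => ⟨hx, by linarith, by simp⟩⟩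

lemma powBdd_const {l : Filter ℝ} {Λ : ℝ → ℝ} (h : ∀ᶠ x in l, 1 ≤ Λ x) {c : ℝ} (hc : 0 ≤ c) :
    PowBdd l Λ (fun _ => c) 0 :=
  ⟨c, hc, h.mono fun x hx => ⟨hx, hc, by simp⟩⟩

end

end

end NLS

theorem theorem3p1 (L₀ : ℝ) (hL₀ : 0 < L₀) :
    ∃ c : ℝ, 0 < c ∧
      (∀ (L : ℝ) [Fact (0 < L)], L₀ ≤ L → ∀ γ : ℝ, 0 < γ →
        ∀ f : NLS.L2per L, f ≠ 0 → ∀ m : ℕ,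
          L / (2 * Real.pi) * NLS.K11 c γ ‖f‖ - 1 ≤ (m : ℝ) → NLS.IsDetermining γ f m) ∧
      (∀ L γ : ℝ, L₀ ≤ L → 0 < γ →
        (fun F : ℝ => (NLS.modeCount c L γ F : ℝ)) =O[atTop] (fun F : ℝ => F ^ 10)) ∧
      (∀ L F : ℝ, L₀ ≤ L → 0 < F →
        (fun γ : ℝ => (NLS.modeCount c L γ F : ℝ)) =O[𝓝[>] (0 : ℝ)]
          (fun γ : ℝ => (γ ^ 12)⁻¹)) := by
  have hL₀' : 0 < 1 / L₀ := by positivity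
  obtain ⟨c₁, hc₁⟩ : ∃ c₁ : ℝ, c₁ = 1 / L₀ + 2 := ⟨_, rfl⟩
  have h2 : 2 ≤ c₁ := by linarith
  have h4 : 4 ≤ c₁ ^ 2 := by nlinarith
  have h5 : 0 ≤ c₁ ^ 4 := by positivity
  have hc0 : 0 < c₁ + 5832 * c₁ ^ 2 + c₁ ^ 4 := by positivity
  refine ⟨c₁ + 5832 * c₁ ^ 2 + c₁ ^ 4, hc0, ?_, ?_, ?_⟩
  · intro L _ hLL γ hγ f _ m hm
    exact NLS.isDetermining_of_K11_le hL₀ hLL hc₁ (by linarith) (by linarith) (by linarith)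
      (by linarith) hγ hm
  · intro L γ hLL hγ
    have hΛ : ∀ᶠ F : ℝ in atTop, 1 ≤ F := eventually_ge_atTop 1
    refine NLS.isBigO_modeCount (Λ := fun F => F) (γ := fun _ => γ) (F := fun F => F)
      (hL₀.trans_le hLL) ?_
    refine (NLS.PowBdd.K11 hc0 zero_le_one le_rfl (NLS.powBdd_self hΛ)
      (NLS.powBdd_const hΛ hγ.le) ?_).mono (by norm_num)
    rw [neg_zero]
    exact NLS.powBdd_const hΛ (inv_nonneg.2 hγ.le)
  · intro L F hLL hF
    have hpos : ∀ᶠ γ : ℝ in 𝓝[>] 0, 0 < γ ∧ γ ≤ 1 := by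
      filter_upwards [Ioc_mem_nhdsGT (zero_lt_one' ℝ)] with γ hγ using hγ
    have hΛ : ∀ᶠ γ : ℝ in 𝓝[>] 0, 1 ≤ γ⁻¹ :=
      hpos.mono fun γ hγ => (one_le_inv₀ hγ.1).2 hγ.2
    simp_rw [← inv_pow]
    refine NLS.isBigO_modeCount (Λ := fun γ => γ⁻¹) (γ := fun γ => γ) (F := fun _ => F)
      (hL₀.trans_le hLL) ?_
    refine (NLS.PowBdd.K11 (a := 0) (b := -1) hc0 le_rfl (by norm_num)
      (NLS.powBdd_const hΛ hF.le) ?_ ?_).mono (by norm_num)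
    · refine ⟨1, zero_le_one, ?_⟩
      filter_upwards [hpos, hΛ] with γ hγ hγ'
      refine ⟨hγ', hγ.1.le, ?_⟩
      rw [Real.rpow_neg_one, inv_inv, one_mul]
    · rw [neg_neg]
      exact NLS.powBdd_self hΛ
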